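/- **Theorem (weak recovery threshold and overlap distribution for 1-step QAOA).** Fix an integer $q\ge 2$. For each $n$, let $u$ be uniform on $\{\pm1\}^n$ and, independently, let $W\in(\mathbb R^n)^{\otimes q}$ have i.i.d. $\mathcal N(0,1)$ entries. For $\lambda_n\in\mathbb R$ put $$Y=\frac{\lambda_n}{n^{q/2}}\,u^{\otimes q}+\frac1{\sqrt n}\,W ,\qquad C(z)=\frac{\langle Y,z^{\otimes q}\rangle}{n^{(q-2)/2}}\quad(z\in\{\pm1\}^n).$$ On $\mathbb C^{2^n}$, with computational basis $\{|z\rangle: z\in\{\pm1\}^n\}$, let $C$ also denote the diagonal operator $C|z\rangle=C(z)|z\rangle$, let $B=\sum_{j=1}^n X_j$, where $X_j,Z_j$ are the Pauli $x$ and $z$ matrices acting on qubit $j$, let $|s\rangle=2^{-n/2}\sum_z|z\rangle$, and for real $\gamma_n,\beta_n$ let $$|\gamma_n,\beta_n\rangle=e^{-i\beta_nB}e^{-i\gamma_nC}|s\rangle .$$ Let $\mathcal R_{\rm QAOA}=\frac1n\sum_{i=1}^n z_iu_i$, where, given $(u,W)$, $z$ is the outcome of measuring $|\gamma_n,\beta_n\rangle$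 in the computational basis (so $z$ occurs with probability $|\langle z|\gamma_n,\beta_n\rangle|^2$). Let $\langle\mathcal R_{\rm QAOA}^2\rangle_{\gamma_n,\beta_n}=\langle\gamma_n,\beta_n|\widehat{\mathcal R}^2|\gamma_n,\beta_n\rangle$ with $\widehat{\mathcal R}=\frac1n\sum_{i=1}^n u_iZ_i$, and let $\mathbb E_Y$ denote expectation over $(u,W)$. Then: (a) For all sequences $\gamma_n\in\mathbb R$, $\beta_n\in[0,2\pi]$, $\lambda_n\in[0,\infty)$ with $\lim_{n\to\infty}\lambda_n/n^{(q-1)/2}=0$, $$\lim_{n\to\infty}\mathbb E_Y\big[\langle\mathcal R_{\rm QAOA}^2\rangle_{\gamma_n,\beta_n}\big]=0 .$$ (b) For all real sequences with $\lim_{n\to\infty}(\gamma_n,\beta_n,\lambda_n/n^{(q-1)/2})=(\gamma,\beta,\Lambda)\in\mathbb R^3$, over the joint randomness of $(u,W)$ and of the quantum measurement, $$\mathcal R_{\rm QAOA}\ \stackrel{d}{\longrightarrow}\ e^{-2q\gamma^2}\sin(2\beta)\,\sin\!\big(2q\Lambda\gamma\,G^{q-1}\big),\qquad G\sim\mathcal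 N(0,1).$$ (c) If, in the situation of (b), $\Lambda>0$, $\gamma>0$ and $\beta\notin\{k\pi/2:k\in\mathbb Z\}$, then $\lim_{n\to\infty}\mathbb E_Y[\langle\mathcal R_{\rm QAOA}^2\rangle_{\gamma_n,\beta_n}]$ exists and is strictly positive. -/

import Mathlib

open MeasureTheory ProbabilityTheory Filter Topology
open scoped Matrix

noncomputable section

namespace SpikedTensorQAOA

/-- Bit strings `z ∈ {+1, -1}ⁿ`. -/
abbrev Spins (n : ℕ) : Type := Fin n → ℤˣ

instance instMeasurableSingletonClassSign : MeasurableSingletonClass ℤˣ :=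
  ⟨fun a => ⟨{(a : ℤ)}, measurableSet_singleton _, by
    ext b
    simp [Units.ext_iff]⟩⟩

/-- The real value `±1` of a sign. -/
def val (a : ℤˣ) : ℝ := ((a : ℤ) : ℝ)

/-- Real tensors of order `q` on `ℝⁿ`, by their entries. -/
abbrev Tensor (q n : ℕ) : Type := (Fin q → Fin n) → ℝ

/-! ### The spiked tensor model -/

/-- The rank-one tensor `z^{⊗ q}`. -/
def tensorPow (q : ℕ) {n : ℕ} (z : Spins n) : Tensor q n := fun j => ∏ k, val (z (j k))

/-- `Y = (lam / n^{q/2}) u^{⊗ q} + (1/√n) W`. -/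
def spikedTensor {q n : ℕ} (lam : ℝ) (u : Spins n) (W : Tensor q n) : Tensor q n :=
  fun j => lam / (n : ℝ) ^ ((q : ℝ) / 2) * tensorPow q u j + 1 / √(n : ℝ) * W j

/-- The law of the signal and the noise `(u, W)`: they are independent, `u` is uniform on
`{±1}ⁿ`, and the entries of `W` are i.i.d. standard Gaussians. -/
def prior (q n : ℕ) : Measure (Spins n × Tensor q n) :=
  (PMF.uniformOfFintype (Spins n)).toMeasure.prod
    (Measure.pi fun _ : Fin q → Fin n => gaussianReal 0 1)

instance (q n : ℕ) : IsProbabilityMeasure (prior q n) := by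
  unfold prior
  infer_instance

/-- The cost function `C(z) = ⟨Y, z^{⊗ q}⟩ / n^{(q-2)/2}`. -/
def cost {q n : ℕ} (Y : Tensor q n) (z : Spins n) : ℝ :=
  (∑ j, Y j * tensorPow q z j) / (n : ℝ) ^ (((q : ℝ) - 2) / 2)

/-! ### The one-step QAOA -/

/-- Operators on `n` qubits, in the computational basis, which is indexed by `{±1}ⁿ`. -/
abbrev Operator (n : ℕ) : Type := Matrix (Spins n) (Spins n) ℂ

/-- The Pauli matrix `σ_x` in the basis indexed by `+1, -1`. -/
def sigmaX : Matrix ℤˣ ℤˣ ℂ := Matrix.of fun a b => if a = b then 0 else 1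

/-- The Pauli matrix `σ_z` in the basis indexed by `+1, -1`. -/
def sigmaZ : Matrix ℤˣ ℤˣ ℂ := Matrix.diagonal fun a => (val a : ℂ)

/-- The Kronecker product `I ⊗ ⋯ ⊗ A ⊗ ⋯ ⊗ I`, with `A` acting on the qubit `k`. -/
def onQubit {n : ℕ} (k : Fin n) (A : Matrix ℤˣ ℤˣ ℂ) : Operator n :=
  Matrix.of fun z z' => ∏ j, (if j = k then A else 1) (z j) (z' j)

/-- `B = ∑ⱼ Xⱼ`. -/
def mixer (n : ℕ) : Operator n := ∑ j, onQubit j sigmaX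

/-- The cost function as a diagonal operator. -/
def costOperator {q n : ℕ} (Y : Tensor q n) : Operator n :=
  Matrix.diagonal fun z => (cost Y z : ℂ)

/-- The uniform superposition `|s⟩ = 2^{-n/2} ∑_z |z⟩`. -/
def uniformState (n : ℕ) : Spins n → ℂ := fun _ => ((1 / √((2 : ℝ) ^ n) : ℝ) : ℂ)

/-- The one-step QAOA state `|γ, β⟩ = e^{-iβB} e^{-iγC} |s⟩`. -/
def qaoaState {q n : ℕ} (γ β : ℝ) (Y : Tensor q n) : Spins n → ℂ :=
  NormedSpace.exp (-(Complex.I * (β : ℂ)) • mixer n) *ᵥ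
    (NormedSpace.exp (-(Complex.I * (γ : ℂ)) • costOperator Y) *ᵥ uniformState n)

/-- The law on `{±1}ⁿ` of the outcome of measuring a state in the computational basis. -/
def bornMeasure {n : ℕ} (ψ : Spins n → ℂ) : Measure (Spins n) :=
  ∑ z, ENNReal.ofReal (‖ψ z‖ ^ 2) • Measure.dirac z

lemma bornMeasure_univ {n : ℕ} (ψ : Spins n → ℂ) :
    bornMeasure ψ Set.univ = ENNReal.ofReal (∑ z, ‖ψ z‖ ^ 2) := by
  rw [bornMeasure, ENNReal.ofReal_sum_of_nonneg (fun _ _ => by positivity)]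
  simp

lemma exp_unitary {n : ℕ} (A : Operator n) (hA : Aᴴ = A) (t : ℝ) :
    (NormedSpace.exp (-(Complex.I * (t : ℂ)) • A))ᴴ *
      NormedSpace.exp (-(Complex.I * (t : ℂ)) • A) = 1 := by
  set M := -(Complex.I * (t : ℂ)) • A with hM
  have h : Mᴴ = -M := by
    rw [hM, Matrix.conjTranspose_smul, hA, ← neg_smul]
    congr 1
    simp
  rw [← Matrix.exp_conjTranspose, h, Matrix.exp_neg]
  exact Matrix.nonsing_inv_mul _ ((Matrix.isUnit_iff_isUnit_det _).1 (Matrix.isUnit_exp M))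

lemma sum_norm_sq_mulVec {n : ℕ} (U : Operator n) (hU : Uᴴ * U = 1) (ψ : Spins n → ℂ) :
    ∑ z, ‖(U *ᵥ ψ) z‖ ^ 2 = ∑ z, ‖ψ z‖ ^ 2 := by
  have key : ∀ φ : Spins n → ℂ, star φ ⬝ᵥ φ = ((∑ z, ‖φ z‖ ^ 2 : ℝ) : ℂ) := by
    intro φ
    simp only [dotProduct, Pi.star_apply, RCLike.star_def, Complex.conj_mul', Complex.ofReal_sum,
      Complex.ofReal_pow]
  have h : star (U *ᵥ ψ) ⬝ᵥ (U *ᵥ ψ) = star ψ ⬝ᵥ ψ := by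
    rw [Matrix.star_mulVec, Matrix.dotProduct_mulVec, Matrix.vecMul_vecMul, hU, Matrix.vecMul_one]
  rw [key, key] at h
  exact_mod_cast h

lemma mixer_hermitian (n : ℕ) : (mixer n)ᴴ = mixer n := by
  rw [mixer, Matrix.conjTranspose_sum]
  refine Finset.sum_congr rfl fun k _ => ?_
  ext z z'
  simp only [onQubit, Matrix.conjTranspose_apply, Matrix.of_apply, star_prod]
  refine Finset.prod_congr rfl fun j _ => ?_
  by_cases hj : j = k
  · by_cases hz : z j = z' j <;> simp [hj, sigmaX] <;> simp_all [eq_comm]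
  · by_cases hz : z j = z' j
    · rw [hz]
      simp [hj]
    · simp [hj, Matrix.one_apply_ne hz, Matrix.one_apply_ne (Ne.symm hz)]

lemma costOperator_hermitian {q n : ℕ} (Y : Tensor q n) : (costOperator Y)ᴴ = costOperator Y := by
  rw [costOperator, Matrix.diagonal_conjTranspose]
  congr 1
  ext z
  simp

/-- The QAOA state is a unit vector. -/
lemma qaoaState_norm {q n : ℕ} (γ β : ℝ) (Y : Tensor q n) :
    ∑ z, ‖qaoaState γ β Y z‖ ^ 2 = 1 := by
  rw [qaoaState, sum_norm_sq_mulVec _ (exp_unitary _ (mixer_hermitian n) β),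
    sum_norm_sq_mulVec _ (exp_unitary _ (costOperator_hermitian Y) γ)]
  simp [uniformState]

lemma measurable_cost {q n : ℕ} (z : Spins n) : Measurable fun Y : Tensor q n => cost Y z := by
  unfold cost
  fun_prop

lemma measurable_qaoaState {q n : ℕ} (γ β : ℝ) (z : Spins n) :
    Measurable fun Y : Tensor q n => qaoaState γ β Y z := by
  have h : ∀ Y : Tensor q n, qaoaState γ β Y z =
      ∑ x, NormedSpace.exp (-(Complex.I * (β : ℂ)) • mixer n) z x *
        (Complex.exp (-(Complex.I * (γ : ℂ)) * (cost Y x : ℂ)) * uniformState n x) := by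
    intro Y
    have hd : NormedSpace.exp (-(Complex.I * (γ : ℂ)) • costOperator Y) =
        Matrix.diagonal fun x => Complex.exp (-(Complex.I * (γ : ℂ)) * (cost Y x : ℂ)) := by
      rw [costOperator, ← Matrix.diagonal_smul, Matrix.exp_diagonal]
      congr 1
      ext x
      rw [Pi.coe_exp, Complex.exp_eq_exp_ℂ]
      simp
    rw [qaoaState, hd]
    simp only [Matrix.mulVec, dotProduct, Matrix.diagonal_apply,
      ite_mul, zero_mul, Finset.sum_ite_eq, Finset.mem_univ, if_true]
  simp only [h]
  have := fun x : Spins n => measurable_cost (q := q) x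
  fun_prop

/-- The measurement of the QAOA state: given the tensor `Y`, the conditional law of the
measured bit string. -/
def measurement (q n : ℕ) (γ β : ℝ) : Kernel (Tensor q n) (Spins n) where
  toFun Y := bornMeasure (qaoaState γ β Y)
  measurable' := by
    refine Measure.measurable_of_measurable_coe _ fun s _ => ?_
    simp only [bornMeasure, Measure.coe_finsetSum, Finset.sum_apply, Measure.smul_apply,
      smul_eq_mul]
    have := fun z : Spins n => measurable_qaoaState (q := q) γ β z
    fun_prop

instance (q n : ℕ) (γ β : ℝ) : IsMarkovKernel (measurement q n γ β) :=
  ⟨fun Y => ⟨by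
    change bornMeasure (qaoaState γ β Y) Set.univ = 1
    rw [bornMeasure_univ, qaoaState_norm, ENNReal.ofReal_one]⟩⟩

lemma measurable_spikedTensor (q n : ℕ) (lam : ℝ) :
    Measurable fun p : Spins n × Tensor q n => spikedTensor lam p.1 p.2 := by
  refine measurable_pi_iff.2 fun j => ?_
  have h : Measurable fun u : Spins n => tensorPow q u j := measurable_of_countable _
  have h' : Measurable fun p : Spins n × Tensor q n => tensorPow q p.1 j := h.comp measurable_fst
  unfold spikedTensor
  fun_prop

/-- The joint law of `((u, W), z)`: draw `(u, W)`, form the spiked tensor `Y`, prepare the QAOA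
state for `Y` and measure it, with outcome `z`. -/
def jointLaw (q n : ℕ) (lam γ β : ℝ) : Measure ((Spins n × Tensor q n) × Spins n) :=
  prior q n ⊗ₘ (measurement q n γ β).comap (fun p : Spins n × Tensor q n =>
    spikedTensor lam p.1 p.2) (measurable_spikedTensor q n lam)

instance (q n : ℕ) (lam γ β : ℝ) : IsProbabilityMeasure (jointLaw q n lam γ β) := by
  unfold jointLaw
  infer_instance

/-- The overlap `(1/n) ∑ᵢ zᵢ uᵢ`. -/
def overlap {n : ℕ} (z u : Spins n) : ℝ := 1 / (n : ℝ) * ∑ i, val (z i) * val (u i)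

/-- The overlap as a random variable under the joint law. -/
def overlapRV (q n : ℕ) (ω : (Spins n × Tensor q n) × Spins n) : ℝ := overlap ω.2 ω.1.1

/-! ### The second moment -/

/-- The overlap operator `R̂ = (1/n) ∑ᵢ uᵢ Zᵢ`. -/
def overlapOperator {n : ℕ} (u : Spins n) : Operator n :=
  (1 / (n : ℂ)) • ∑ i, (val (u i) : ℂ) • onQubit i sigmaZ

/-- The expectation `⟨ψ| A |ψ⟩` of an observable (a Hermitian operator, so that the value is
real). -/
def quantumExpectation {n : ℕ} (ψ : Spins n → ℂ) (A : Operator n) : ℝ :=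
  (star ψ ⬝ᵥ (A *ᵥ ψ)).re

/-- `E_Y[⟨R²⟩_{γ, β}]`: the quantum expectation of the squared overlap, averaged over the signal
and the noise. -/
def secondMoment (q n : ℕ) (lam γ β : ℝ) : ℝ :=
  ∫ p, quantumExpectation (qaoaState γ β (spikedTensor lam p.1 p.2)) (overlapOperator p.1 ^ 2)
    ∂(prior q n)

lemma onQubit_sigmaZ {n : ℕ} (i : Fin n) :
    onQubit i sigmaZ = Matrix.diagonal fun z : Spins n => (val (z i) : ℂ) := by
  ext z z'
  by_cases h : z = z'
  · subst h
    simp only [onQubit, Matrix.of_apply, Matrix.diagonal_apply_eq]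
    rw [Finset.prod_eq_single i]
    · simp [sigmaZ]
    · intro j _ hj
      simp [hj]
    · simp
  · obtain ⟨j, hj⟩ := Function.ne_iff.1 h
    rw [Matrix.diagonal_apply_ne _ h]
    refine Finset.prod_eq_zero (Finset.mem_univ j) ?_
    by_cases hji : j = i
    · simpa [hji, sigmaZ] using Matrix.diagonal_apply_ne _ (hji ▸ hj)
    · simp [hji, Matrix.one_apply_ne hj]

lemma overlapOperator_eq {n : ℕ} (u : Spins n) :
    overlapOperator u = Matrix.diagonal fun z => (overlap z u : ℂ) := by
  ext z z'
  by_cases h : z = z'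
  · subst h
    simp [overlapOperator, onQubit_sigmaZ, overlap, Matrix.sum_apply, mul_comm]
  · simp [overlapOperator, onQubit_sigmaZ, Matrix.sum_apply, h]

/-- The quantum expectation of the squared overlap is the mean of the squared overlap of the
measured bit string. -/
lemma quantumExpectation_overlap {n : ℕ} (ψ : Spins n → ℂ) (u : Spins n) :
    quantumExpectation ψ (overlapOperator u ^ 2) = ∫ z, overlap z u ^ 2 ∂(bornMeasure ψ) := by
  have h : ∀ z : Spins n, Integrable (fun z => overlap z u ^ 2)
      (ENNReal.ofReal (‖ψ z‖ ^ 2) • Measure.dirac z) := fun z =>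
    (integrable_dirac (by simp)).smul_measure ENNReal.ofReal_ne_top
  rw [bornMeasure, integral_finsetSum_measure fun z _ => h z, quantumExpectation,
    overlapOperator_eq, Matrix.diagonal_pow]
  simp only [dotProduct, Complex.re_sum]
  refine Finset.sum_congr rfl fun z _ => ?_
  rw [integral_smul_measure, integral_dirac, ENNReal.toReal_ofReal (by positivity), smul_eq_mul,
    Matrix.mulVec_diagonal, mul_left_comm, Pi.star_apply, RCLike.star_def, Complex.conj_mul']
  simp only [Pi.pow_apply]
  rw [← Complex.ofReal_pow, ← Complex.ofReal_pow, ← Complex.ofReal_mul, Complex.ofReal_re, mul_comm]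

end SpikedTensorQAOA

end

noncomputable section

open scoped BigOperators

namespace SpikedTensorQAOA

/-! ### The mixing unitary in the computational basis -/

/-! The overlap is bounded by one, so its law is governed by its moments: the `k`-th moment is the
average over `k`-tuples of sites of `meanCorr`, the mean of a product of the `z_i u_i`
(`integral_overlap_pow`). All but a vanishing fraction of tuples have distinct entries, and for
those the correlation is an explicit finite sum.

In the Heisenberg picture the mixer turns each `Z_i` into `cos 2β Z_i + sin 2β Y_i` and leaves the
other qubits alone. Hence only pairs of basis states `x`, `x τ` that differ inside the `k` chosen
sites interfere: `2^k` flips `t` instead of `2^n`. The Gaussian average over `W` turns each pair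
into a phase coming from the signal times a damping factor, and the substitution `x ↦ u x` removes
`u` (`meanCorr_eq`).

With `s = n^{-1/2} ∑ x_i` and `Λ_n = λ_n / n^{(q-1)/2}`, the signal phase is `γ Λ_n √n` times the
change of `s^q`. A flip changes `s` by `O(n^{-1/2})`, so for bounded `γ Λ_n` the phase is of order
one and linear in the flips up to a small error, while the damping tends to `e^{-2qγ²}` per flip.
The linearized sum over flips factorizes over sites (`sum_linearTerm`), and averaging over tuples
gives a `k`-th power whose base is `limitOverlap` at `s` plus a term carrying the factor `s/√n`. The
central limit theorem for `s` yields the moments of the sine-Gaussian law. Weierstrass approximation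
on `[-1, 1]` upgrades this to convergence in distribution, which is (b); `k = 2` with positivity of
the limiting moment gives (c).

For (a) neither `γ_n` nor `β_n` need converge, and `γ_n` may be unbounded. With the phase factor
replaced by `1`, a two-site correlation averages to zero by spin-flip symmetry. The error is at most
damping times phase, and the damping absorbs the factor `|γ|` (`abs_mul_noiseDamp_le`), leaving a
bound by a constant times `|Λ_n|` uniformly in `γ` and `β`. -/

/-- The entries of `e^{-iβ σ_x}`. -/
def mixerEntry (β : ℝ) (a b : ℤˣ) : ℂ :=
  if a = b then Complex.cos β else -Complex.I * Complex.sin β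

/-- The Kronecker product of a family of one-qubit matrices. -/
def tensorMatrix {n : ℕ} (A : Fin n → Matrix ℤˣ ℤˣ ℂ) : Operator n :=
  Matrix.of fun z z' => ∏ j, A j (z j) (z' j)

lemma tensorMatrix_mul {n : ℕ} (A B : Fin n → Matrix ℤˣ ℤˣ ℂ) :
    tensorMatrix A * tensorMatrix B = tensorMatrix fun j => A j * B j := by
  ext z z'
  simp only [tensorMatrix, Matrix.mul_apply, Matrix.of_apply, ← Finset.prod_mul_distrib]
  rw [Finset.prod_univ_sum, Fintype.piFinset_univ]

lemma tensorMatrix_diagonal {n : ℕ} (d : Fin n → ℤˣ → ℂ) :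
    tensorMatrix (fun j => Matrix.diagonal (d j)) =
      Matrix.diagonal fun z : Spins n => ∏ j, d j (z j) := by
  ext z z'
  by_cases h : z = z'
  · subst h
    simp [tensorMatrix]
  · obtain ⟨j, hj⟩ := Function.ne_iff.1 h
    rw [Matrix.diagonal_apply_ne _ h]
    exact Finset.prod_eq_zero (Finset.mem_univ j) (Matrix.diagonal_apply_ne _ hj)

lemma tensorMatrix_one {n : ℕ} : tensorMatrix (fun _ : Fin n => 1) = 1 := by
  have := tensorMatrix_diagonal (fun (_ : Fin n) (_ : ℤˣ) => (1 : ℂ))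
  simpa using this

lemma onQubit_eq_tensorMatrix {n : ℕ} (k : Fin n) (A : Matrix ℤˣ ℤˣ ℂ) :
    onQubit k A = tensorMatrix fun j => if j = k then A else 1 := rfl

/-- The unnormalized Hadamard matrix. -/
def hadamard : Matrix ℤˣ ℤˣ ℂ := Matrix.of fun a b => if a = 1 then 1 else (val b : ℂ)

lemma sum_sign {M : Type*} [AddCommMonoid M] (f : ℤˣ → M) : ∑ a, f a = f 1 + f (-1) := by
  rw [show (Finset.univ : Finset ℤˣ) = {1, -1} from rfl]
  exact Finset.sum_pair (by decide)

lemma forall_sign {p : ℤˣ → Prop} (h1 : p 1) (h2 : p (-1)) (a : ℤˣ) : p a := by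
  rcases Int.units_eq_one_or a with rfl | rfl
  exacts [h1, h2]

@[simp] lemma val_one : val 1 = 1 := by simp [val]

@[simp] lemma val_neg_one : val (-1) = -1 := by simp [val]

lemma val_mul (a b : ℤˣ) : val (a * b) = val a * val b := by simp [val]

lemma abs_val (a : ℤˣ) : |val a| = 1 := by
  revert a
  exact forall_sign (by simp) (by simp)

lemma neg_one_ne_one_sign : (-1 : ℤˣ) ≠ 1 := by decide

/-- The columns of `hadamard` are eigenvectors of `sigmaX` with eigenvalues `±1`; this diagonalizes
the mixer one qubit at a time. -/
lemma sigmaX_mul_hadamard : sigmaX * hadamard = hadamard * sigmaZ := by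
  ext a b
  revert a b
  refine forall_sign (forall_sign ?_ ?_) (forall_sign ?_ ?_) <;>
    simp [Matrix.mul_apply, sigmaX, sigmaZ, hadamard, neg_one_ne_one_sign.symm]

lemma hadamard_mul_half_hadamard : hadamard * ((1 / 2 : ℂ) • hadamard) = 1 := by
  ext a b
  revert a b
  refine forall_sign (forall_sign ?_ ?_) (forall_sign ?_ ?_) <;>
    simp [Matrix.mul_apply, hadamard, neg_one_ne_one_sign.symm] ; norm_num

lemma hadamard_conj_phase (β : ℝ) :
    hadamard * Matrix.diagonal (fun a => Complex.exp (-(Complex.I * β) * val a)) *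
      ((1 / 2 : ℂ) • hadamard) = Matrix.of (mixerEntry β) := by
  have h1 : Complex.exp (-(Complex.I * β)) = Complex.cos β - Complex.sin β * Complex.I := by
    rw [show -(Complex.I * (β : ℂ)) = (-β : ℂ) * Complex.I by ring, Complex.exp_mul_I,
      Complex.cos_neg, Complex.sin_neg]
    ring
  have h2 : Complex.exp (Complex.I * β) = Complex.cos β + Complex.sin β * Complex.I := by
    rw [mul_comm, Complex.exp_mul_I]
  ext a b
  revert a b
  refine forall_sign (forall_sign ?_ ?_) (forall_sign ?_ ?_) <;>
    simp [Matrix.mul_apply, hadamard, mixerEntry, h1, h2, neg_one_ne_one_sign.symm] <;> ring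

/-- The mixing unitary factorizes over the qubits. -/
lemma exp_mixer (n : ℕ) (β : ℝ) :
    NormedSpace.exp (-(Complex.I * (β : ℂ)) • mixer n) = 
      tensorMatrix fun _ => Matrix.of (mixerEntry β) := by
  set U : Operator n := tensorMatrix fun _ => hadamard with hU
  set V : Operator n := tensorMatrix fun _ => (1 / 2 : ℂ) • hadamard with hV
  have hUV : U * V = 1 := by
    rw [hU, hV, tensorMatrix_mul]
    simp only [hadamard_mul_half_hadamard, tensorMatrix_one]
  have hinv : U⁻¹ = V := Matrix.inv_eq_right_inv hUV
  have hunit : IsUnit U := IsUnit.of_mul_eq_one V hUV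
  have hBU : mixer n * U = U * ∑ k, onQubit k sigmaZ := by
    rw [mixer, Finset.sum_mul, Finset.mul_sum]
    refine Finset.sum_congr rfl fun k _ => ?_
    rw [onQubit_eq_tensorMatrix, onQubit_eq_tensorMatrix, hU, tensorMatrix_mul, tensorMatrix_mul]
    congr 1
    ext1 j
    by_cases hj : j = k
    · simp [hj, sigmaX_mul_hadamard]
    · simp [hj]
  have hsum : (-(Complex.I * (β : ℂ))) • ∑ k, onQubit k sigmaZ =
      Matrix.diagonal fun z : Spins n => ∑ j, -(Complex.I * (β : ℂ)) * val (z j) := by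
    simp only [onQubit_sigmaZ]
    ext z z'
    by_cases h : z = z'
    · subst h
      simp [Matrix.sum_apply, Finset.mul_sum]
    · simp [Matrix.sum_apply, h]
  -- The mixer is conjugate to a sum of one-qubit diagonal matrices, whose exponential is taken
  -- entrywise and is a Kronecker product.
  have hB : -(Complex.I * (β : ℂ)) • mixer n =
      U * (-(Complex.I * (β : ℂ)) • ∑ k, onQubit k sigmaZ) * U⁻¹ := by
    rw [hinv, Matrix.mul_smul, ← hBU, Matrix.smul_mul, Matrix.mul_assoc, hUV, Matrix.mul_one]
  have hexp : NormedSpace.exp (Matrix.diagonal fun z : Spins n =>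
        ∑ j, -(Complex.I * (β : ℂ)) * val (z j)) =
      tensorMatrix fun _ => Matrix.diagonal (fun a => Complex.exp (-(Complex.I * β) * val a)) := by
    rw [Matrix.exp_diagonal, tensorMatrix_diagonal]
    congr 1
    ext z
    rw [Pi.coe_exp, ← Complex.exp_eq_exp_ℂ, Complex.exp_sum]
  rw [hB, Matrix.exp_conj _ _ hunit, hsum, hexp, hinv, hU, hV, tensorMatrix_mul, tensorMatrix_mul]
  simp only [hadamard_conj_phase]

/-! ### Correlations of the measured spins -/

/-- The amplitude of flipping (`t = -1`) or keeping (`t = 1`) a spin in the Heisenberg picture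
of `σ_z` under the mixer. -/
def flipAmp (β : ℝ) (t : ℤˣ) : ℂ :=
  if t = 1 then Complex.cos (2 * β) else Complex.I * Complex.sin (2 * β)

lemma conj_cos_ofReal (β : ℝ) : (starRingEnd ℂ) (Complex.cos β) = Complex.cos β := by
  rw [← Complex.cos_conj, Complex.conj_ofReal]

lemma conj_sin_ofReal (β : ℝ) : (starRingEnd ℂ) (Complex.sin β) = Complex.sin β := by
  rw [← Complex.sin_conj, Complex.conj_ofReal]

/-- Unitarity of `e^{-iβσ_x}`: at an unmeasured site the two interfering basis states must agree. -/
lemma sum_mixerEntry (β : ℝ) (a t : ℤˣ) :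
    ∑ z, mixerEntry β z a * (starRingEnd ℂ) (mixerEntry β z (a * t)) = if t = 1 then 1 else 0 := by
  have h := Complex.sin_sq_add_cos_sq (β : ℂ)
  revert a t
  refine forall_sign (forall_sign ?_ ?_) (forall_sign ?_ ?_) <;>
    simp [mixerEntry, neg_one_ne_one_sign.symm, conj_cos_ofReal,
      conj_sin_ofReal] <;> first | ring1 | linear_combination h - Complex.sin β ^ 2 * Complex.I_sq

/-- The matrix entries of `e^{iβσ_x} σ_z e^{-iβσ_x}`, by the double-angle formulas. -/
lemma sum_val_mul_mixerEntry (β : ℝ) (a t : ℤˣ) :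
    ∑ z, (val z : ℂ) * (mixerEntry β z a * (starRingEnd ℂ) (mixerEntry β z (a * t))) =
      val a * flipAmp β t := by
  have hs := Complex.sin_two_mul (β : ℂ)
  have hc := Complex.cos_two_mul' (β : ℂ)
  revert a t
  refine forall_sign (forall_sign ?_ ?_) (forall_sign ?_ ?_) <;>
    simp [mixerEntry, neg_one_ne_one_sign.symm, conj_cos_ofReal,
      conj_sin_ofReal, flipAmp, hs, hc] <;> ring_nf <;> simp; ring

open Classical in
lemma sum_prod_mixerEntry {n k : ℕ} (β : ℝ) {i : Fin k → Fin n} (hi : Function.Injective i)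
    (x τ : Spins n) :
    ∑ z : Spins n, (∏ l, (val (z (i l)) : ℂ)) *
        ∏ j, (mixerEntry β (z j) (x j) * (starRingEnd ℂ) (mixerEntry β (z j) (x j * τ j))) =
      ∏ j, if j ∈ Set.range i then val (x j) * flipAmp β (τ j)
        else if τ j = 1 then 1 else 0 := by
  have h : ∀ z : Spins n, ∏ l, (val (z (i l)) : ℂ) =
      ∏ j, if j ∈ Set.range i then (val (z j) : ℂ) else 1 := fun z =>
    Fintype.prod_of_injective i hi _ _ (fun j hj => if_neg hj) (fun l => by simp)
  simp only [h, ← Finset.prod_mul_distrib]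
  have h' := Finset.prod_univ_sum (fun _ : Fin n => (Finset.univ : Finset ℤˣ))
    fun j a => (if j ∈ Set.range i then (val a : ℂ) else 1) *
      (mixerEntry β a (x j) * (starRingEnd ℂ) (mixerEntry β a (x j * τ j)))
  rw [Fintype.piFinset_univ] at h'
  rw [← h']
  refine Finset.prod_congr rfl fun j _ => ?_
  by_cases hj : j ∈ Set.range i
  · simp only [if_pos hj, sum_val_mul_mixerEntry]
  · simp only [if_neg hj, one_mul, sum_mixerEntry]

open Classical in
-- The weight vanishes unless `τ` is `1` off the range of `i`, so `τ` is the extension by `1` of a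
-- flip pattern `t` on the `k` chosen sites.
lemma sum_flips {n k : ℕ} (β : ℝ) {i : Fin k → Fin n} (hi : Function.Injective i)
    (x : Spins n) (F : Spins n → ℂ) :
    ∑ τ : Spins n, (∏ j, if j ∈ Set.range i then val (x j) * flipAmp β (τ j)
        else if τ j = 1 then 1 else 0) * F τ =
      ∑ t : Spins k, (∏ l, (val (x (i l)) : ℂ) * flipAmp β (t l)) * F (Function.extend i t 1) := by
  symm
  refine Fintype.sum_of_injective (fun t : Spins k => (Function.extend i t 1 : Spins n)) ?_ _ _ ?_ ?_
  · intro t t' h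
    ext1 l
    have := congrFun h (i l)
    simpa [hi.extend_apply] using this
  · intro τ hτ
    obtain ⟨j, hj, hj'⟩ : ∃ j, j ∉ Set.range i ∧ τ j ≠ 1 := by
      by_contra! hcon
      refine hτ ⟨τ ∘ i, ?_⟩
      ext1 j
      by_cases hj : j ∈ Set.range i
      · obtain ⟨l, rfl⟩ := hj
        simp [hi.extend_apply]
      · simp only [Function.extend_apply' _ _ _ hj, hcon j hj, Pi.one_apply]
    rw [Finset.prod_eq_zero (Finset.mem_univ j), zero_mul]
    rw [if_neg hj, if_neg hj']
  · intro t
    congr 1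
    refine Fintype.prod_of_injective i hi _ _ (fun j hj => ?_) (fun l => ?_)
    · rw [if_neg hj, Function.extend_apply' _ _ _ hj]
      simp
    · simp [hi.extend_apply]

lemma exp_costOperator {q n : ℕ} (γ : ℝ) (Y : Tensor q n) :
    NormedSpace.exp (-(Complex.I * (γ : ℂ)) • costOperator Y) =
      Matrix.diagonal fun x => Complex.exp (-(Complex.I * (γ : ℂ)) * (cost Y x : ℂ)) := by
  rw [costOperator, ← Matrix.diagonal_smul, Matrix.exp_diagonal]
  congr 1
  ext x
  rw [Pi.coe_exp, Complex.exp_eq_exp_ℂ]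
  simp

lemma qaoaState_apply {q n : ℕ} (γ β : ℝ) (Y : Tensor q n) (z : Spins n) :
    qaoaState γ β Y z = ∑ x, (∏ j, mixerEntry β (z j) (x j)) *
      (Complex.exp (-(Complex.I * (γ : ℂ)) * (cost Y x : ℂ)) * ((1 / √((2 : ℝ) ^ n) : ℝ) : ℂ)) := by
  rw [qaoaState, exp_costOperator, exp_mixer]
  simp only [Matrix.mulVec, dotProduct, Matrix.diagonal_apply, ite_mul, zero_mul,
    Finset.sum_ite_eq, Finset.mem_univ, if_true, uniformState, tensorMatrix, Matrix.of_apply]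

/-- The Born probabilities in terms of pairs `x, x τ` of basis states. -/
lemma normSq_qaoaState {q n : ℕ} (γ β : ℝ) (Y : Tensor q n) (z : Spins n) :
    ((‖qaoaState γ β Y z‖ ^ 2 : ℝ) : ℂ) = 𝔼 x : Spins n, ∑ τ : Spins n,
      (∏ j, (mixerEntry β (z j) (x j) * (starRingEnd ℂ) (mixerEntry β (z j) (x j * τ j)))) *
        Complex.exp (Complex.I * ((γ * (cost Y (x * τ) - cost Y x) : ℝ) : ℂ)) := by
  have h2 : (((1 / √((2 : ℝ) ^ n) : ℝ) : ℂ)) * ((1 / √((2 : ℝ) ^ n) : ℝ) : ℂ) =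
      (1 / (2 : ℂ) ^ n) := by
    rw [← Complex.ofReal_mul, div_mul_div_comm, Real.mul_self_sqrt (by positivity)]
    simp
  rw [Complex.ofReal_pow, ← Complex.mul_conj', qaoaState_apply, map_sum, Finset.sum_mul_sum,
    Fintype.expect_eq_sum_div_card, Finset.sum_div]
  refine Finset.sum_congr rfl fun x _ => ?_
  rw [Finset.sum_div]
  -- The second basis state of the squared amplitude is written `x τ`; the two normalizations
  -- `2^{-n/2}` make the sum over `x` an average.
  rw [← Equiv.sum_comp (Equiv.mulLeft x)]
  refine Finset.sum_congr rfl fun τ _ => ?_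
  simp only [map_mul, Complex.conj_ofReal, map_prod, Equiv.coe_mulLeft, Pi.mul_apply,
    Finset.prod_mul_distrib, ← Complex.exp_conj, map_neg, Complex.conj_I]
  have h3 : Complex.exp (Complex.I * ((γ * (cost Y (x * τ) - cost Y x) : ℝ) : ℂ)) =
      Complex.exp (-(Complex.I * (γ : ℂ)) * (cost Y x : ℂ)) *
      Complex.exp (-(-Complex.I * (γ : ℂ)) * (cost Y (x * τ) : ℂ)) := by
    rw [← Complex.exp_add]
    congr 1
    push_cast
    ring
  have h4 : (Fintype.card (Spins n) : ℂ) = 2 ^ n := by simp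
  rw [h3, h4]
  linear_combination (∏ j, mixerEntry β (z j) (x j)) *
    (∏ j, (starRingEnd ℂ) (mixerEntry β (z j) (x j * τ j))) *
      Complex.exp (-(Complex.I * (γ : ℂ)) * (cost Y x : ℂ)) *
      Complex.exp (-(-Complex.I * (γ : ℂ)) * (cost Y (x * τ) : ℂ)) * h2

/-- The correlation of the spins `i 0, …, i (k - 1)` in the QAOA state. -/
lemma sum_normSq_mul_prod {q n k : ℕ} (γ β : ℝ) (Y : Tensor q n) {i : Fin k → Fin n}
    (hi : Function.Injective i) :
    ((∑ z, ‖qaoaState γ β Y z‖ ^ 2 * ∏ l, val (z (i l)) : ℝ) : ℂ) =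
      𝔼 x : Spins n, ∑ t : Spins k, (∏ l, (val (x (i l)) : ℂ) * flipAmp β (t l)) *
        Complex.exp (Complex.I *
          ((γ * (cost Y (x * Function.extend i t 1) - cost Y x) : ℝ) : ℂ)) := by
  classical
  simp only [Complex.ofReal_sum, Complex.ofReal_mul (‖_‖ ^ 2), normSq_qaoaState, Finset.expect_mul]
  rw [← Finset.expect_sum_comm]
  refine Finset.expect_congr rfl fun x _ => ?_
  rw [← sum_flips β hi x fun τ => Complex.exp (Complex.I *
          ((γ * (cost Y (x * τ) - cost Y x) : ℝ) : ℂ))]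
  simp only [← sum_prod_mixerEntry β hi, Finset.sum_mul]
  rw [Finset.sum_comm]
  refine Finset.sum_congr rfl fun τ _ => Finset.sum_congr rfl fun z _ => ?_
  push_cast
  ring

/-! ### Averaging over the noise and the signal -/

/-- The total spin `∑ᵢ xᵢ`. -/
def spinSum {n : ℕ} (x : Spins n) : ℝ := ∑ i, val (x i)

/-- The inner product of rank-one tensors is the `q`-th power of the inner product of vectors. This
gives both the signal term of the cost and the variance of the noise. -/
lemma sum_tensorPow_mul (q : ℕ) {n : ℕ} (u x : Spins n) :
    ∑ j, tensorPow q u j * tensorPow q x j = spinSum (u * x) ^ q := by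
  have h := Finset.prod_univ_sum (fun _ : Fin q => (Finset.univ : Finset (Fin n)))
    fun _ i => val (u i) * val (x i)
  rw [Fintype.piFinset_univ] at h
  simp only [tensorPow, ← Finset.prod_mul_distrib, ← h, spinSum, Pi.mul_apply, val_mul,
    Finset.prod_const, Finset.card_univ, Fintype.card_fin]

lemma spinSum_one (n : ℕ) : spinSum (1 : Spins n) = n := by simp [spinSum]

lemma spins_mul_self {n : ℕ} (x : Spins n) : x * x = 1 := by
  ext1 i
  exact Int.units_mul_self (x i)

lemma rpow_half_mul_self {q n : ℕ} (hq : 1 ≤ q) (hn : 0 < n) :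
    (n : ℝ) ^ (((q : ℝ) - 1) / 2) * (n : ℝ) ^ (((q : ℝ) - 1) / 2) = (n : ℝ) ^ (q - 1) := by
  have hn' : (0 : ℝ) < n := by exact_mod_cast hn
  rw [← Real.rpow_add hn', ← Real.rpow_natCast, Nat.cast_sub hq]
  congr 1
  push_cast
  ring

lemma cost_spikedTensor {q n : ℕ} (hq : 1 ≤ q) (hn : 0 < n) (lam : ℝ) (u x : Spins n)
    (W : Tensor q n) :
    cost (spikedTensor lam u W) x = lam / (n : ℝ) ^ (q - 1) * spinSum (u * x) ^ q +
      ∑ j, W j * (tensorPow q x j / (n : ℝ) ^ (((q : ℝ) - 1) / 2)) := by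
  have hn' : (0 : ℝ) < n := by exact_mod_cast hn
  have h1 : (n : ℝ) ^ ((q : ℝ) / 2) * (n : ℝ) ^ (((q : ℝ) - 2) / 2) = (n : ℝ) ^ (q - 1) := by
    rw [← Real.rpow_add hn', ← Real.rpow_natCast, Nat.cast_sub hq]
    congr 1
    push_cast
    ring
  have h2 : √(n : ℝ) * (n : ℝ) ^ (((q : ℝ) - 2) / 2) = (n : ℝ) ^ (((q : ℝ) - 1) / 2) := by
    rw [Real.sqrt_eq_rpow, ← Real.rpow_add hn']
    congr 1
    ring
  rw [cost, ← sum_tensorPow_mul, Finset.mul_sum, ← Finset.sum_add_distrib, Finset.sum_div]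
  refine Finset.sum_congr rfl fun j _ => ?_
  rw [spikedTensor, ← h1, ← h2]
  field_simp

lemma integral_exp_gaussian {ι : Type*} [Fintype ι] (c : ι → ℝ) :
    ∫ W : ι → ℝ, Complex.exp (Complex.I * ((∑ j, W j * c j : ℝ) : ℂ))
      ∂(Measure.pi fun _ => gaussianReal 0 1) = Complex.exp ((-(∑ j, c j ^ 2) / 2 : ℝ) : ℂ) := by
  have h : ∀ W : ι → ℝ, Complex.exp (Complex.I * ((∑ j, W j * c j : ℝ) : ℂ)) =
      ∏ j, Complex.exp ((c j : ℂ) * (W j : ℂ) * Complex.I) := by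
    intro W
    rw [← Complex.exp_sum]
    push_cast
    rw [Finset.mul_sum]
    congr 1
    exact Finset.sum_congr rfl fun j _ => by ring
  simp only [h]
  rw [integral_fintype_prod_eq_prod (f := fun j (w : ℝ) =>
    Complex.exp ((c j : ℂ) * (w : ℂ) * Complex.I))]
  simp only [← charFun_apply_real, charFun_gaussianReal]
  rw [← Complex.exp_sum]
  congr 1
  push_cast
  rw [neg_div, Finset.sum_div, ← Finset.sum_neg_distrib]
  exact Finset.sum_congr rfl fun j _ => by ring

/-- The phase difference of the signal part of the cost between `x` and `x τ`. -/
def signalPhase (q : ℕ) {n : ℕ} (lam γ : ℝ) (x τ : Spins n) : ℝ :=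
  γ * lam / (n : ℝ) ^ (q - 1) * (spinSum (x * τ) ^ q - spinSum x ^ q)

/-- The damping produced by the noise on the pairs `x, x τ`. -/
def damping (q : ℕ) {n : ℕ} (γ : ℝ) (τ : Spins n) : ℝ :=
  Real.exp (-(γ ^ 2 / (n : ℝ) ^ (q - 1) * ((n : ℝ) ^ q - spinSum τ ^ q)))

/-- The noise part of the phase difference is a centred Gaussian of variance `γ² ‖(xτ)^{⊗q} -
x^{⊗q}‖² / n^{q-1} = 2γ² (n^q - (∑ τ_j)^q) / n^{q-1}`. Its characteristic function involves half of
that, which depends on `τ` only. -/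
lemma integral_noise {q n : ℕ} (hq : 1 ≤ q) (hn : 0 < n) (lam γ : ℝ) (u x τ : Spins n) :
    ∫ W : Tensor q n, Complex.exp (Complex.I * ((γ * (cost (spikedTensor lam u W) (x * τ) -
        cost (spikedTensor lam u W) x) : ℝ) : ℂ)) ∂(Measure.pi fun _ => gaussianReal 0 1) =
      damping q γ τ * Complex.exp (Complex.I * signalPhase q lam γ (u * x) τ) := by
  set a : ℝ := (n : ℝ) ^ (((q : ℝ) - 1) / 2) with ha
  have hn' : (0 : ℝ) < n := by exact_mod_cast hn
  have ha0 : a ≠ 0 := (Real.rpow_pos_of_pos hn' _).ne'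
  have haa := rpow_half_mul_self hq hn
  rw [← ha] at haa
  set c : (Fin q → Fin n) → ℝ := fun j => γ * (tensorPow q (x * τ) j - tensorPow q x j) / a with hc
  have h : ∀ W : Tensor q n, Complex.exp (Complex.I * ((γ * (cost (spikedTensor lam u W) (x * τ) -
        cost (spikedTensor lam u W) x) : ℝ) : ℂ)) =
      Complex.exp (Complex.I * signalPhase q lam γ (u * x) τ) *
        Complex.exp (Complex.I * ((∑ j, W j * c j : ℝ) : ℂ)) := by
    intro W
    rw [← Complex.exp_add, ← mul_add, ← Complex.ofReal_add]
    congr 3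
    rw [cost_spikedTensor hq hn, cost_spikedTensor hq hn, ← ha, signalPhase, ← mul_assoc]
    have : ∑ j, W j * c j = γ * (∑ j, W j * (tensorPow q (x * τ) j / a) -
        ∑ j, W j * (tensorPow q x j / a)) := by
      rw [← Finset.sum_sub_distrib, Finset.mul_sum]
      refine Finset.sum_congr rfl fun j _ => ?_
      simp only [hc]
      ring
    rw [this]
    ring
  simp only [h]
  rw [integral_const_mul, integral_exp_gaussian, mul_comm, ← Complex.ofReal_exp]
  congr 2
  unfold damping
  congr 1
  have hsum : ∑ j, c j ^ 2 = γ ^ 2 / (a * a) * (∑ j, tensorPow q (x * τ) j * tensorPow q (x * τ) j +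
      ∑ j, tensorPow q x j * tensorPow q x j - 2 * ∑ j, tensorPow q (x * τ) j * tensorPow q x j) := by
    rw [Finset.mul_sum, ← Finset.sum_add_distrib, ← Finset.sum_sub_distrib, Finset.mul_sum]
    refine Finset.sum_congr rfl fun j _ => ?_
    simp only [hc]
    field_simp
    ring
  have hxt : x * τ * x = τ := by rw [mul_comm x τ, mul_assoc, spins_mul_self, mul_one]
  rw [hsum, sum_tensorPow_mul, sum_tensorPow_mul, sum_tensorPow_mul, spins_mul_self,
    spins_mul_self, hxt, spinSum_one, haa]
  ring

lemma norm_exp_I_mul_ofReal (a : ℝ) : ‖Complex.exp (Complex.I * (a : ℂ))‖ = 1 := by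
  rw [mul_comm, Complex.norm_exp_ofReal_mul_I]

lemma measurable_qaoaState_prior {q n : ℕ} (lam γ β : ℝ) (z : Spins n) :
    Measurable fun p : Spins n × Tensor q n => qaoaState γ β (spikedTensor lam p.1 p.2) z :=
  (measurable_qaoaState γ β z).comp (measurable_spikedTensor q n lam)

lemma normSq_qaoaState_le_one {q n : ℕ} (γ β : ℝ) (Y : Tensor q n) (z : Spins n) :
    ‖qaoaState γ β Y z‖ ^ 2 ≤ 1 := by
  rw [← qaoaState_norm γ β Y]
  exact Finset.single_le_sum (f := fun z => ‖qaoaState γ β Y z‖ ^ 2)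
    (fun _ _ => by positivity) (Finset.mem_univ z)

lemma integrable_bornSum (q n : ℕ) (lam γ β : ℝ) (g : Spins n → Spins n → ℝ) :
    Integrable (fun p : Spins n × Tensor q n =>
      ∑ z, ‖qaoaState γ β (spikedTensor lam p.1 p.2) z‖ ^ 2 * g z p.1) (prior q n) := by
  refine integrable_finsetSum _ fun z _ => ?_
  refine Integrable.of_bound (C := ∑ u, |g z u|) ?_ (ae_of_all _ fun p => ?_)
  · have h1 := measurable_qaoaState_prior (q := q) lam γ β z
    have h2 : Measurable fun p : Spins n × Tensor q n => g z p.1 :=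
      (measurable_of_countable (g z)).comp measurable_fst
    exact ((h1.norm.pow_const 2).mul h2).aestronglyMeasurable
  · rw [norm_mul, norm_pow, norm_norm, Real.norm_eq_abs]
    calc _ ≤ 1 * |g z p.1| := by
          gcongr
          exact normSq_qaoaState_le_one _ _ _ _
      _ ≤ _ := by
          rw [one_mul]
          exact Finset.single_le_sum (f := fun u => |g z u|) (fun _ _ => abs_nonneg _)
            (Finset.mem_univ p.1)

lemma integral_bornMeasure {n : ℕ} (ψ : Spins n → ℂ) (f : Spins n → ℝ) :
    ∫ z, f z ∂(bornMeasure ψ) = ∑ z, ‖ψ z‖ ^ 2 * f z := by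
  rw [bornMeasure, integral_finsetSum_measure fun z _ =>
    (integrable_dirac (by simp)).smul_measure ENNReal.ofReal_ne_top]
  refine Finset.sum_congr rfl fun z _ => ?_
  rw [integral_smul_measure, integral_dirac, ENNReal.toReal_ofReal (by positivity), smul_eq_mul]

lemma integral_jointLaw (q n : ℕ) (lam γ β : ℝ) (g : Spins n → Spins n → ℝ) :
    ∫ ω, g ω.2 ω.1.1 ∂(jointLaw q n lam γ β) =
      ∫ p, ∑ z, ‖qaoaState γ β (spikedTensor lam p.1 p.2) z‖ ^ 2 * g z p.1 ∂(prior q n) := by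
  have hint : Integrable (fun ω : (Spins n × Tensor q n) × Spins n => g ω.2 ω.1.1)
      (jointLaw q n lam γ β) := by
    have hm : Measurable fun ω : (Spins n × Tensor q n) × Spins n => (ω.2, ω.1.1) := by fun_prop
    exact Integrable.comp_measurable (f := fun ω : (Spins n × Tensor q n) × Spins n => (ω.2, ω.1.1))
      (g := fun a : Spins n × Spins n => g a.1 a.2) (Integrable.of_finite) hm
  rw [jointLaw, Measure.integral_compProd hint]
  refine integral_congr_ae (ae_of_all _ fun p => ?_)
  exact integral_bornMeasure _ fun z => g z p.1

/-- The correlation of the spins `z_{i 0} u_{i 0}, …`, averaged over everything. -/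
def meanCorr (q : ℕ) {n k : ℕ} (lam γ β : ℝ) (i : Fin k → Fin n) : ℝ :=
  ∫ p, ∑ z, ‖qaoaState γ β (spikedTensor lam p.1 p.2) z‖ ^ 2 *
    ∏ l, (val (z (i l)) * val (p.1 (i l))) ∂(prior q n)

lemma abs_meanCorr_le (q : ℕ) {n k : ℕ} (lam γ β : ℝ) (i : Fin k → Fin n) :
    |meanCorr q lam γ β i| ≤ 1 := by
  rw [meanCorr, ← Real.norm_eq_abs]
  refine (norm_integral_le_of_norm_le_const (C := 1) (ae_of_all _ fun p => ?_)).trans (by simp)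
  refine (norm_sum_le _ _).trans ?_
  simp only [Real.norm_eq_abs, abs_mul, abs_pow, abs_norm, Finset.abs_prod, abs_val, mul_one,
    Finset.prod_const_one]
  exact (qaoaState_norm γ β _).le

lemma overlap_pow {n : ℕ} (k : ℕ) (z u : Spins n) :
    overlap z u ^ k = 𝔼 i : Fin k → Fin n, ∏ l, (val (z (i l)) * val (u (i l))) := by
  have h : overlap z u = 𝔼 i : Fin n, val (z i) * val (u i) := by
    rw [overlap, Fintype.expect_eq_sum_div_card, Fintype.card_fin]
    ring
  rw [h, Finset.expect_pow, Fintype.piFinset_univ]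

lemma integral_overlap_pow (q n k : ℕ) (lam γ β : ℝ) :
    ∫ ω, overlapRV q n ω ^ k ∂(jointLaw q n lam γ β) =
      𝔼 i : Fin k → Fin n, meanCorr q lam γ β i := by
  have h := integral_jointLaw q n lam γ β fun z u => overlap z u ^ k
  unfold overlapRV
  rw [h]
  simp only [overlap_pow, meanCorr, Fintype.expect_eq_sum_div_card]
  rw [← integral_finsetSum _ fun i _ => integrable_bornSum q n lam γ β
    fun z u => ∏ l, (val (z (i l)) * val (u (i l))), ← integral_div]
  refine integral_congr_ae (ae_of_all _ fun p => ?_)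
  simp only
  rw [Finset.sum_comm, Finset.sum_div]
  refine Finset.sum_congr rfl fun z _ => ?_
  rw [← Finset.mul_sum, mul_div_assoc]

lemma secondMoment_eq (q n : ℕ) (lam γ β : ℝ) :
    secondMoment q n lam γ β = ∫ ω, overlapRV q n ω ^ 2 ∂(jointLaw q n lam γ β) := by
  have h := integral_jointLaw q n lam γ β fun z u => overlap z u ^ 2
  unfold overlapRV
  rw [h, secondMoment]
  simp only [quantumExpectation_overlap, integral_bornMeasure]

lemma integral_uniform {n : ℕ} {𝕜 : Type*} [RCLike 𝕜] (f : Spins n → 𝕜) :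
    ∫ x, f x ∂(PMF.uniformOfFintype (Spins n)).toMeasure = 𝔼 x, f x := by
  rw [PMF.integral_eq_sum, Fintype.expect_eq_sum_div_card, Finset.sum_div]
  refine Finset.sum_congr rfl fun x _ => ?_
  rw [PMF.uniformOfFintype_apply, RCLike.real_smul_eq_coe_mul, div_eq_inv_mul]
  simp [map_ofNat]

lemma integrable_phase {q n : ℕ} (lam γ : ℝ) (u x τ : Spins n) :
    Integrable (fun W : Tensor q n =>
      Complex.exp (Complex.I * ((γ * (cost (spikedTensor lam u W) (x * τ) -
        cost (spikedTensor lam u W) x) : ℝ) : ℂ))) (Measure.pi fun _ => gaussianReal 0 1) := by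
  have h : Measurable fun W : Tensor q n => spikedTensor lam u W := by
    refine measurable_pi_iff.2 fun j => ?_
    unfold spikedTensor
    exact ((measurable_pi_apply j).const_mul _).const_add _
  have h1 := (measurable_cost (q := q) (x * τ)).comp h
  have h2 := (measurable_cost (q := q) x).comp h
  refine Integrable.of_bound (C := 1) (Measurable.aestronglyMeasurable ?_)
    (ae_of_all _ fun W => (norm_exp_I_mul_ofReal _).le)
  exact Complex.measurable_exp.comp (measurable_const.mul
    (Complex.measurable_ofReal.comp ((h1.sub h2).const_mul γ)))

/-- The contribution of the pair `x, x τ`, with `τ` flipping the spins `i l` with `t l = -1`. -/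
def pairTerm (q : ℕ) {n k : ℕ} (lam γ β : ℝ) (i : Fin k → Fin n) (x : Spins n) (t : Spins k) : ℂ :=
  (∏ l, (val (x (i l)) : ℂ) * flipAmp β (t l)) *
    (damping q γ (Function.extend i t 1 : Spins n) *
      Complex.exp (Complex.I * signalPhase q lam γ x (Function.extend i t 1)))

lemma integral_corr {q n k : ℕ} (hq : 1 ≤ q) (hn : 0 < n) (lam γ β : ℝ) {i : Fin k → Fin n}
    (hi : Function.Injective i) (u : Spins n) :
    ∫ W : Tensor q n, ((∑ z, ‖qaoaState γ β (spikedTensor lam u W) z‖ ^ 2 *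
        ∏ l, (val (z (i l)) * val (u (i l))) : ℝ) : ℂ) ∂(Measure.pi fun _ => gaussianReal 0 1) =
      𝔼 x : Spins n, ∑ t : Spins k, pairTerm q lam γ β i x t := by
  have h1 : ∀ W : Tensor q n, ((∑ z, ‖qaoaState γ β (spikedTensor lam u W) z‖ ^ 2 *
      ∏ l, (val (z (i l)) * val (u (i l))) : ℝ) : ℂ) =
      ∑ x : Spins n, ∑ t : Spins k,
        ((∏ l, (val (u (i l)) : ℂ)) * (∏ l, (val (x (i l)) : ℂ) * flipAmp β (t l)) /
          (Fintype.card (Spins n) : ℂ)) *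
        Complex.exp (Complex.I * ((γ * (cost (spikedTensor lam u W) (x * Function.extend i t 1) -
          cost (spikedTensor lam u W) x) : ℝ) : ℂ)) := by
    intro W
    simp only [Finset.prod_mul_distrib, ← mul_assoc, ← Finset.sum_mul]
    rw [Complex.ofReal_mul, sum_normSq_mul_prod γ β _ hi, Fintype.expect_eq_sum_div_card,
      div_mul_eq_mul_div, Finset.sum_mul, Finset.sum_div]
    refine Finset.sum_congr rfl fun x _ => ?_
    rw [Finset.sum_mul, Finset.sum_div]
    refine Finset.sum_congr rfl fun t _ => ?_
    push_cast
    rw [Finset.prod_mul_distrib]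
    ring
  -- Gauge symmetry: `x ↦ u x` preserves the average over `x` and absorbs the factors `u_i`, so the
  -- result no longer depends on `u`.
  have h2 : ∑ x : Spins n, ∑ t : Spins k, pairTerm q lam γ β i x t =
      ∑ x : Spins n, ∑ t : Spins k, pairTerm q lam γ β i (u * x) t :=
    (Equiv.sum_comp (Equiv.mulLeft u) fun x => ∑ t : Spins k, pairTerm q lam γ β i x t).symm
  simp only [h1]
  rw [integral_finsetSum _ fun x _ => integrable_finsetSum _ fun t _ =>
      (integrable_phase lam γ u x _).const_mul _,
    Fintype.expect_eq_sum_div_card, h2, Finset.sum_div]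
  refine Finset.sum_congr rfl fun x _ => ?_
  rw [integral_finsetSum _ fun t _ => (integrable_phase lam γ u x _).const_mul _, Finset.sum_div]
  refine Finset.sum_congr rfl fun t _ => ?_
  rw [integral_const_mul, integral_noise hq hn]
  simp only [pairTerm, Pi.mul_apply, val_mul, Finset.prod_mul_distrib, Complex.ofReal_mul]
  ring

/-- The averaged correlation for distinct sites, as a finite sum. -/
lemma meanCorr_eq {q n k : ℕ} (hq : 1 ≤ q) (hn : 0 < n) (lam γ β : ℝ) {i : Fin k → Fin n}
    (hi : Function.Injective i) :
    (meanCorr q lam γ β i : ℂ) = 𝔼 x : Spins n, ∑ t : Spins k, pairTerm q lam γ β i x t := by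
  have hI : Integrable (fun p : Spins n × Tensor q n =>
      ((∑ z, ‖qaoaState γ β (spikedTensor lam p.1 p.2) z‖ ^ 2 *
        ∏ l, (val (z (i l)) * val (p.1 (i l))) : ℝ) : ℂ))
      ((PMF.uniformOfFintype (Spins n)).toMeasure.prod
        (Measure.pi fun _ : Fin q → Fin n => gaussianReal 0 1)) :=
    (integrable_bornSum q n lam γ β fun z u => ∏ l, (val (z (i l)) * val (u (i l)))).ofReal
  rw [meanCorr, ← integral_complex_ofReal, prior, integral_prod _ hI]
  simp only [integral_corr hq hn lam γ β hi, integral_const, probReal_univ, one_smul]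

/-! ### The normalized total spin -/

/-- The total spin divided by `√n`. -/
def scaledSpin {n : ℕ} (x : Spins n) : ℝ := spinSum x / √(n : ℝ)

lemma expect_prod_sign {n : ℕ} {𝕜 : Type*} [RCLike 𝕜] (f : ℤˣ → 𝕜) :
    𝔼 x : Spins n, ∏ j, f (x j) = ((f 1 + f (-1)) / 2) ^ n := by
  have h := Finset.prod_univ_sum (fun _ : Fin n => (Finset.univ : Finset ℤˣ)) fun _ a => f a
  rw [Fintype.piFinset_univ] at h
  rw [Fintype.expect_eq_sum_div_card, ← h, Finset.prod_const, sum_sign, div_pow]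
  simp

/-- Independence of the spins gives a power of `cosh`, and `cosh y ≤ e^{y²/2}` makes the bound
uniform in `n`. -/
lemma expect_exp_scaledSpin_le (n : ℕ) (c : ℝ) :
    𝔼 x : Spins n, Real.exp (c * scaledSpin x) ≤ Real.exp (c ^ 2 / 2) := by
  have h : ∀ x : Spins n, Real.exp (c * scaledSpin x) =
      ∏ j, Real.exp (c / √(n : ℝ) * val (x j)) := by
    intro x
    rw [← Real.exp_sum, ← Finset.mul_sum, scaledSpin, spinSum]
    congr 1
    ring
  simp only [h]
  rw [expect_prod_sign fun a => Real.exp (c / √(n : ℝ) * val a)]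
  simp only [val_one, val_neg_one, mul_one, mul_neg, ← Real.cosh_eq]
  rcases Nat.eq_zero_or_pos n with rfl | hn
  · simpa using by positivity
  have hn' : (0 : ℝ) < n := by exact_mod_cast hn
  calc Real.cosh (c / √(n : ℝ)) ^ n ≤ Real.exp ((c / √(n : ℝ)) ^ 2 / 2) ^ n := by
        gcongr
        exact Real.cosh_le_exp_half_sq _
    _ = _ := by
        rw [← Real.exp_nat_mul, div_pow, Real.sq_sqrt hn'.le]
        congr 1
        field_simp

/-- Exponential moments at `±1` dominate every polynomial one. Uniformity in `n` is what turns
pointwise errors that are polynomial in `|s|` into errors of the averages. -/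
lemma exists_expect_scaledSpin_le (p : ℕ) :
    ∃ M : ℝ, 0 ≤ M ∧ ∀ n : ℕ, 𝔼 x : Spins n, (1 + |scaledSpin x|) ^ p ≤ M := by
  refine ⟨p.factorial * Real.exp 1 * (Real.exp (1 / 2) + Real.exp (1 / 2)), by positivity,
    fun n => ?_⟩
  have h1 := expect_exp_scaledSpin_le n 1
  have h2 := expect_exp_scaledSpin_le n (-1)
  norm_num at h1 h2
  calc 𝔼 x : Spins n, (1 + |scaledSpin x|) ^ p
      ≤ 𝔼 x : Spins n, p.factorial * Real.exp 1 *
          (Real.exp (scaledSpin x) + Real.exp (-scaledSpin x)) := by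
        refine Finset.expect_le_expect fun x _ => ?_
        have h3 := Real.pow_div_factorial_le_exp (x := 1 + |scaledSpin x|) (by positivity) p
        rw [div_le_iff₀ (by positivity), Real.exp_add] at h3
        have h4 : Real.exp |scaledSpin x| ≤ Real.exp (scaledSpin x) + Real.exp (-scaledSpin x) := by
          rcases abs_cases (scaledSpin x) with ⟨h, _⟩ | ⟨h, _⟩ <;> rw [h]
          · linarith [Real.exp_pos (-scaledSpin x)]
          · linarith [Real.exp_pos (scaledSpin x)]
        calc _ ≤ _ := h3
          _ = p.factorial * Real.exp 1 * Real.exp |scaledSpin x| := by ring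
          _ ≤ _ := by gcongr
    _ = p.factorial * Real.exp 1 * (𝔼 x : Spins n, Real.exp (scaledSpin x) +
          𝔼 x : Spins n, Real.exp (-scaledSpin x)) := by
        rw [← Finset.expect_add_distrib, Finset.mul_expect]
    _ ≤ _ := by
        norm_num
        gcongr

/-- The law of a uniform sign. -/
def signLaw : Measure ℤˣ := (PMF.uniformOfFintype ℤˣ).toMeasure

instance : IsProbabilityMeasure signLaw := by
  unfold signLaw
  infer_instance

lemma integral_signLaw {𝕜 : Type*} [RCLike 𝕜] (f : ℤˣ → 𝕜) :
    ∫ a, f a ∂signLaw = (f 1 + f (-1)) / 2 := by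
  rw [signLaw, PMF.integral_eq_sum, sum_sign]
  simp only [PMF.uniformOfFintype_apply, RCLike.real_smul_eq_coe_mul]
  simp [map_ofNat]
  ring

/-- The law of the normalized total spin. -/
def scaledSpinLaw (n : ℕ) : ProbabilityMeasure ℝ :=
  ⟨((PMF.uniformOfFintype (Spins n)).toMeasure).map scaledSpin,
    Measure.isProbabilityMeasure_map (measurable_of_countable _).aemeasurable⟩

lemma charFun_scaledSpinLaw (n : ℕ) (t : ℝ) :
    charFun (scaledSpinLaw n : Measure ℝ) t =
      charFun (signLaw.map val) ((√(n : ℝ))⁻¹ * t) ^ n := by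
  have hm : Measurable val := measurable_of_countable _
  have hm' : Measurable (scaledSpin (n := n)) := measurable_of_countable _
  rw [charFun_apply_real, charFun_apply_real, integral_map hm.aemeasurable
    (by fun_prop), integral_signLaw, scaledSpinLaw, ProbabilityMeasure.coe_mk,
    integral_map hm'.aemeasurable (by fun_prop), integral_uniform,
    ← expect_prod_sign fun a => Complex.exp (((√(n : ℝ))⁻¹ * t : ℝ) * (val a : ℂ) * Complex.I)]
  refine Finset.expect_congr rfl fun x _ => ?_
  rw [← Complex.exp_sum, ← Finset.sum_mul, ← Finset.mul_sum, scaledSpin, spinSum]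
  push_cast
  congr 1
  ring

/-- The central limit theorem for the total spin. -/
lemma tendsto_scaledSpinLaw :
    Tendsto scaledSpinLaw atTop (𝓝 ⟨gaussianReal 0 1, inferInstance⟩) := by
  refine ProbabilityMeasure.tendsto_iff_tendsto_charFun.2 fun t => ?_
  have hm : Measurable val := measurable_of_countable _
  have h := tendsto_charFun_inv_sqrt_mul_pow (P := signLaw) (X := val) hm.aemeasurable
    (by rw [integral_signLaw (𝕜 := ℝ)]; simp) (by
      simp only [Pi.pow_apply]
      rw [integral_signLaw (𝕜 := ℝ)]; simp) t
  simp only [charFun_scaledSpinLaw]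
  rw [ProbabilityMeasure.coe_mk, charFun_gaussianReal]
  convert h using 3
  simp [neg_div]

lemma tendsto_expect_scaledSpin {f : ℝ → ℝ} (hf : Continuous f) {C : ℝ} (hC : ∀ s, |f s| ≤ C) :
    Tendsto (fun n : ℕ => 𝔼 x : Spins n, f (scaledSpin x)) atTop
      (𝓝 (∫ g, f g ∂(gaussianReal 0 1))) := by
  have h := ProbabilityMeasure.tendsto_iff_forall_integral_tendsto.1 tendsto_scaledSpinLaw
    (BoundedContinuousFunction.ofNormedAddCommGroup f hf C hC)
  refine (tendsto_congr fun n => ?_).1 h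
  have hm' : Measurable (scaledSpin (n := n)) := measurable_of_countable _
  simp only [scaledSpinLaw, ProbabilityMeasure.coe_mk]
  rw [integral_map hm'.aemeasurable (by fun_prop), integral_uniform]
  rfl

/-! ### Perturbation of powers -/

lemma abs_pow_sub_pow_le_of_le {s r B : ℝ} (q : ℕ) (hB : 1 ≤ B) (hs : |s| ≤ B) (hr : |r| ≤ B) :
    |r ^ q - s ^ q| ≤ |r - s| * q * B ^ q := by
  refine (abs_pow_sub_pow_le r s q).trans ?_
  gcongr
  calc max |r| |s| ^ (q - 1) ≤ B ^ (q - 1) := by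
        gcongr
        exact max_le hr hs
    _ ≤ B ^ q := pow_le_pow_right₀ hB (Nat.sub_le _ _)

/-- Second-order Taylor bound for `r^q` around `s`, by induction on `q`. The constants are crude:
`B^q` rather than `B^{q-2}` avoids truncated subtraction, and `q² + q ≤ (q+1)²` closes the
induction. -/
lemma abs_pow_sub_pow_add_le {s r B : ℝ} (q : ℕ) (hB : 1 ≤ B) (hs : |s| ≤ B) (hr : |r| ≤ B) :
    |r ^ q - s ^ q + q * (s - r) * s ^ (q - 1)| ≤ q ^ 2 * (s - r) ^ 2 * B ^ q := by
  have hB0 : 0 ≤ B := by linarith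
  induction q with
  | zero => simp
  | succ q ih =>
    have h1 : r ^ (q + 1) - s ^ (q + 1) + (q + 1 : ℕ) * (s - r) * s ^ (q + 1 - 1) =
        s * (r ^ q - s ^ q + q * (s - r) * s ^ (q - 1)) + (r - s) * (r ^ q - s ^ q) := by
      rcases Nat.eq_zero_or_pos q with rfl | hq
      · simp
      · obtain ⟨m, rfl⟩ := Nat.exists_eq_add_of_lt hq
        simp only [zero_add, Nat.add_sub_cancel]
        push_cast
        ring
    have h2 := abs_pow_sub_pow_le_of_le q hB hs hr
    have h3 : |r - s| * |r - s| = (s - r) ^ 2 := by rw [abs_mul_abs_self]; ring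
    rw [h1]
    calc _ ≤ |s| * |r ^ q - s ^ q + q * (s - r) * s ^ (q - 1)| + |r - s| * |r ^ q - s ^ q| := by
          rw [← abs_mul, ← abs_mul]
          exact abs_add_le _ _
      _ ≤ B * (q ^ 2 * (s - r) ^ 2 * B ^ q) + |r - s| * (|r - s| * q * B ^ q) := by gcongr
      _ = (q ^ 2 * (s - r) ^ 2 * B ^ (q + 1)) + (s - r) ^ 2 * q * B ^ q := by
          rw [← h3]; ring
      _ ≤ (q ^ 2 * (s - r) ^ 2 * B ^ (q + 1)) + (s - r) ^ 2 * q * B ^ (q + 1) := by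
          gcongr
          exact Nat.le_succ q
      _ ≤ _ := by
          push_cast
          have : 0 ≤ (s - r) ^ 2 * B ^ (q + 1) := by positivity
          nlinarith

/-! ### Flipping a bounded number of spins -/

/-- The change of the total spin under the flips `t` of the sites `i`. -/
def flipSum {n k : ℕ} (i : Fin k → Fin n) (x : Spins n) (t : Spins k) : ℝ :=
  ∑ l, val (x (i l)) * (1 - val (t l))

/-- Twice the number of flips. -/
def flipCount {k : ℕ} (t : Spins k) : ℝ := ∑ l, (1 - val (t l))

lemma one_sub_val_nonneg (a : ℤˣ) : 0 ≤ 1 - val a := by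
  linarith [abs_le.1 (abs_val a).le]

lemma flipCount_nonneg {k : ℕ} (t : Spins k) : 0 ≤ flipCount t :=
  Finset.sum_nonneg fun _ _ => one_sub_val_nonneg _

lemma flipCount_le {k : ℕ} (t : Spins k) : flipCount t ≤ 2 * k := by
  calc flipCount t ≤ ∑ _ : Fin k, (2 : ℝ) :=
        Finset.sum_le_sum fun l _ => by linarith [abs_le.1 (abs_val (t l)).le]
    _ = _ := by simp [mul_comm]

lemma abs_flipSum_le {n k : ℕ} (i : Fin k → Fin n) (x : Spins n) (t : Spins k) :
    |flipSum i x t| ≤ flipCount t := by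
  refine (Finset.abs_sum_le_sum_abs _ _).trans (Finset.sum_le_sum fun l _ => ?_)
  rw [abs_mul, abs_val, one_mul, abs_of_nonneg (one_sub_val_nonneg _)]

lemma spinSum_mul_extend {n k : ℕ} {i : Fin k → Fin n} (hi : Function.Injective i) (x : Spins n)
    (t : Spins k) : spinSum (x * Function.extend i t 1) = spinSum x - flipSum i x t := by
  have h : flipSum i x t = ∑ j, val (x j) * (1 - val ((Function.extend i t 1 : Spins n) j)) := by
    refine Fintype.sum_of_injective i hi _ _ (fun j hj => ?_) (fun l => ?_)
    · rw [Function.extend_apply' _ _ _ hj]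
      simp
    · rw [hi.extend_apply]
  rw [h, spinSum, spinSum, ← Finset.sum_sub_distrib]
  refine Finset.sum_congr rfl fun j _ => ?_
  rw [Pi.mul_apply, val_mul]
  ring

lemma spinSum_extend {n k : ℕ} {i : Fin k → Fin n} (hi : Function.Injective i) (t : Spins k) :
    spinSum (Function.extend i t 1 : Spins n) = n - flipCount t := by
  have h := spinSum_mul_extend hi 1 t
  rw [one_mul, spinSum_one] at h
  rw [h]
  simp [flipSum, flipCount]

lemma scaledSpin_mul_extend {n k : ℕ} {i : Fin k → Fin n} (hi : Function.Injective i)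
    (x : Spins n) (t : Spins k) :
    scaledSpin (x * Function.extend i t 1) = scaledSpin x - flipSum i x t / √(n : ℝ) := by
  rw [scaledSpin, spinSum_mul_extend hi, scaledSpin, sub_div]

/-- Isolates the critical ratio `lam / n^{(q-1)/2}`. The remaining factor is of order one for
bounded `s`, since `√n` compensates the `O(n^{-1/2})` effect of boundedly many flips. -/
lemma signalPhase_eq {q n : ℕ} (hq : 1 ≤ q) (hn : 0 < n) (lam γ : ℝ) (x τ : Spins n) :
    signalPhase q lam γ x τ = γ * (lam / (n : ℝ) ^ (((q : ℝ) - 1) / 2)) *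
      (√(n : ℝ) * (scaledSpin (x * τ) ^ q - scaledSpin x ^ q)) := by
  have hn' : (0 : ℝ) < n := by exact_mod_cast hn
  have ha0 : (n : ℝ) ^ (((q : ℝ) - 1) / 2) ≠ 0 := (Real.rpow_pos_of_pos hn' _).ne'
  have hs : √(n : ℝ) ≠ 0 := (Real.sqrt_pos.2 hn').ne'
  have h1 : √(n : ℝ) ^ q = (n : ℝ) ^ (((q : ℝ) - 1) / 2) * √(n : ℝ) := by
    rw [Real.sqrt_eq_rpow, ← Real.rpow_natCast, ← Real.rpow_mul hn'.le, ← Real.rpow_add hn']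
    congr 1
    ring
  rw [signalPhase, ← rpow_half_mul_self hq hn, scaledSpin, scaledSpin, div_pow, div_pow, h1]
  field_simp

/-- The damping as a function of the flips of distinct sites. -/
def noiseDamp (q n : ℕ) {k : ℕ} (γ : ℝ) (t : Spins k) : ℝ :=
  Real.exp (-(γ ^ 2 * (n * (1 - (1 - flipCount t / n) ^ q))))

lemma damping_extend {q n k : ℕ} (hq : 1 ≤ q) (hn : 0 < n) (γ : ℝ) {i : Fin k → Fin n}
    (hi : Function.Injective i) (t : Spins k) :
    damping q γ (Function.extend i t 1 : Spins n) = noiseDamp q n γ t := by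
  have hn' : (n : ℝ) ≠ 0 := by exact_mod_cast hn.ne'
  unfold damping noiseDamp
  congr 2
  rw [spinSum_extend hi]
  have h1 : ((n : ℝ) - flipCount t) ^ q = (n : ℝ) ^ q * (1 - flipCount t / n) ^ q := by
    rw [← mul_pow]
    congr 1
    field_simp
  have h2 : (n : ℝ) ^ q = (n : ℝ) ^ (q - 1) * n := by
    rw [← pow_succ, Nat.sub_add_cancel hq]
  rw [h1, h2]
  field_simp

/-! ### Reduction to distinct sites -/

lemma tendsto_descFactorial_div_pow (k : ℕ) :
    Tendsto (fun n : ℕ => (n.descFactorial k : ℝ) / (n : ℝ) ^ k) atTop (𝓝 1) := by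
  have h1 : Tendsto (fun n : ℕ => (1 - (k : ℝ) / (n : ℝ)) ^ k) atTop (𝓝 1) := by
    have := ((tendsto_const_div_atTop_nhds_zero_nat (k : ℝ)).const_sub 1).pow k
    simpa using this
  refine tendsto_of_tendsto_of_tendsto_of_le_of_le' h1 tendsto_const_nhds ?_ ?_
  · filter_upwards [eventually_ge_atTop (k + 1)] with n hn
    have hn' : (0 : ℝ) < n := by exact_mod_cast (by omega : 0 < n)
    have hkn : (k : ℝ) ≤ n := by exact_mod_cast (by omega : k ≤ n)
    have h2 : (((n + 1 - k : ℕ) : ℝ)) ^ k ≤ (n.descFactorial k : ℝ) := by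
      exact_mod_cast Nat.pow_sub_le_descFactorial n k
    rw [Nat.cast_sub (by omega)] at h2
    push_cast at h2
    rw [le_div_iff₀ (by positivity), ← mul_pow]
    refine le_trans ?_ h2
    have h3 : (1 - (k : ℝ) / n) * n = n - k := by field_simp
    rw [h3]
    gcongr; linarith
  · filter_upwards [eventually_gt_atTop 0] with n hn
    have hn' : (0 : ℝ) < n := by exact_mod_cast hn
    rw [div_le_one (by positivity)]
    exact_mod_cast Nat.descFactorial_le_pow n k

open Classical in
lemma expect_injective {n k : ℕ} :
    𝔼 i : Fin k → Fin n, (if Function.Injective i then (1 : ℝ) else 0) =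
      (n.descFactorial k : ℝ) / (n : ℝ) ^ k := by
  rw [Fintype.expect_eq_sum_div_card, Finset.sum_boole, ← Fintype.card_subtype,
    Fintype.card_congr (Equiv.subtypeInjectiveEquivEmbedding (Fin k) (Fin n)),
    Fintype.card_embedding_eq]
  simp

/-- Averages over `k` sites only depend on the `k`-tuples of distinct sites, asymptotically. -/
lemma tendsto_expect_sub_of_injective {k : ℕ} {F F' : ∀ n : ℕ, (Fin k → Fin n) → ℂ} {C : ℝ}
    {ε : ℕ → ℝ} (hF : ∀ n i, ‖F n i‖ ≤ C) (hF' : ∀ n i, ‖F' n i‖ ≤ C)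
    (hε : Tendsto ε atTop (𝓝 0))
    (h : ∀ᶠ n in atTop, ∀ i : Fin k → Fin n, Function.Injective i → ‖F n i - F' n i‖ ≤ ε n) :
    Tendsto (fun n => 𝔼 i, F n i - 𝔼 i, F' n i) atTop (𝓝 0) := by
  classical
  have hlim : Tendsto (fun n : ℕ => |ε n| + 2 * C * (1 - (n.descFactorial k : ℝ) / (n : ℝ) ^ k))
      atTop (𝓝 0) := by
    have := hε.abs.add (((tendsto_descFactorial_div_pow k).const_sub 1).const_mul (2 * C))
    simpa using this
  refine squeeze_zero_norm' ?_ hlim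
  filter_upwards [h, eventually_gt_atTop 0] with n hn hn0
  have : Nonempty (Fin n) := ⟨⟨0, hn0⟩⟩
  rw [← Finset.expect_sub_distrib, ← expect_injective]
  calc ‖𝔼 i, (F n i - F' n i)‖ ≤ 𝔼 i, ‖F n i - F' n i‖ := RCLike.norm_expect_le (K := ℂ)
    -- Tuples with a repetition are charged the trivial bound `2C`; their proportion vanishes.
    _ ≤ 𝔼 i : Fin k → Fin n,
          (|ε n| + 2 * C * (1 - if Function.Injective i then (1 : ℝ) else 0)) := by
        refine Finset.expect_le_expect fun i _ => ?_
        by_cases hi : Function.Injective i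
        · simpa [hi] using (hn i hi).trans (le_abs_self _)
        · simp only [hi, if_false, sub_zero, mul_one]
          have := norm_sub_le (F n i) (F' n i)
          linarith [hF n i, hF' n i, abs_nonneg (ε n)]
    _ = _ := by
        rw [Finset.expect_add_distrib, ← Finset.mul_expect, Finset.expect_sub_distrib,
          Fintype.expect_const, Fintype.expect_const]

/-! ### The terms of the averaged correlations -/

lemma norm_flipAmp_le (β : ℝ) (t : ℤˣ) : ‖flipAmp β t‖ ≤ 1 := by
  have h : (2 * β : ℂ) = ((2 * β : ℝ) : ℂ) := by push_cast; rfl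
  unfold flipAmp
  split_ifs
  · rw [h, ← Complex.ofReal_cos, Complex.norm_real]
    exact Real.abs_cos_le_one _
  · rw [norm_mul, Complex.norm_I, one_mul, h, ← Complex.ofReal_sin, Complex.norm_real]
    exact Real.abs_sin_le_one _

lemma norm_prod_flipAmp_le {k : ℕ} (β : ℝ) (t : Spins k) : ‖∏ l, flipAmp β (t l)‖ ≤ 1 := by
  rw [norm_prod]
  exact Finset.prod_le_one (fun _ _ => norm_nonneg _) fun _ _ => norm_flipAmp_le _ _

lemma norm_prod_val {n k : ℕ} (i : Fin k → Fin n) (x : Spins n) :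
    ‖∏ l, (val (x (i l)) : ℂ)‖ = 1 := by
  simp [norm_prod, Complex.norm_real, abs_val]

lemma norm_exp_sub_exp_le (a b : ℝ) :
    ‖Complex.exp (Complex.I * (a : ℂ)) - Complex.exp (Complex.I * (b : ℂ))‖ ≤ |a - b| := by
  have h : Complex.exp (Complex.I * (a : ℂ)) - Complex.exp (Complex.I * (b : ℂ)) =
      Complex.exp (Complex.I * (b : ℂ)) * (Complex.exp (Complex.I * ((a - b : ℝ) : ℂ)) - 1) := by
    rw [mul_sub, ← Complex.exp_add, mul_one]
    congr 2
    push_cast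
    ring
  rw [h, norm_mul, norm_exp_I_mul_ofReal, one_mul, ← Real.norm_eq_abs]
  exact Real.norm_exp_I_mul_ofReal_sub_one_le

lemma pairTerm_eq {q n k : ℕ} (hq : 1 ≤ q) (hn : 0 < n) (lam γ β : ℝ) {i : Fin k → Fin n}
    (hi : Function.Injective i) (x : Spins n) (t : Spins k) :
    pairTerm q lam γ β i x t = (∏ l, (val (x (i l)) : ℂ)) *
      ((∏ l, flipAmp β (t l)) * noiseDamp q n γ t *
        Complex.exp (Complex.I * signalPhase q lam γ x (Function.extend i t 1))) := by
  rw [pairTerm, damping_extend hq hn γ hi, Finset.prod_mul_distrib]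
  ring

/-- The common bound on the normalized total spin and on its value after the flips. -/
lemma abs_scaledSpin_extend_le {n k : ℕ} (hn : 0 < n) {i : Fin k → Fin n}
    (hi : Function.Injective i) (x : Spins n) (t : Spins k) :
    1 ≤ (1 + 2 * (k : ℝ)) * (1 + |scaledSpin x|) ∧
      |scaledSpin x| ≤ (1 + 2 * (k : ℝ)) * (1 + |scaledSpin x|) ∧
      |scaledSpin (x * Function.extend i t 1)| ≤ (1 + 2 * (k : ℝ)) * (1 + |scaledSpin x|) := by
  have hk : (0 : ℝ) ≤ k := by positivity
  have hs := abs_nonneg (scaledSpin x)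
  have h1 : 1 ≤ √(n : ℝ) := Real.one_le_sqrt.2 (by exact_mod_cast hn)
  refine ⟨by nlinarith, by nlinarith, ?_⟩
  rw [scaledSpin_mul_extend hi]
  have h2 : |flipSum i x t / √(n : ℝ)| ≤ 2 * k := by
    rw [abs_div, abs_of_nonneg (Real.sqrt_nonneg _)]
    exact (div_le_self (abs_nonneg _) h1).trans ((abs_flipSum_le i x t).trans (flipCount_le t))
  have h3 := abs_sub (scaledSpin x) (flipSum i x t / √(n : ℝ))
  nlinarith

/-- The factors `|γ|` and `flipCount t` are kept explicit because `abs_mul_noiseDamp_le` bounds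
exactly their product with the damping. -/
lemma abs_signalPhase_le {q n k : ℕ} (hq : 1 ≤ q) (hn : 0 < n) (lam γ : ℝ) {i : Fin k → Fin n}
    (hi : Function.Injective i) (x : Spins n) (t : Spins k) :
    |signalPhase q lam γ x (Function.extend i t 1)| ≤
      |γ| * |lam / (n : ℝ) ^ (((q : ℝ) - 1) / 2)| * (flipCount t *
        (q * (1 + 2 * (k : ℝ)) ^ q * (1 + |scaledSpin x|) ^ q)) := by
  obtain ⟨h1, h2, h3⟩ := abs_scaledSpin_extend_le hn hi x t
  have hn' : (0 : ℝ) < √(n : ℝ) := Real.sqrt_pos.2 (by exact_mod_cast hn)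
  rw [signalPhase_eq hq hn, abs_mul, abs_mul, abs_mul, abs_of_pos hn']
  refine mul_le_mul_of_nonneg_left ?_ (by positivity)
  calc _ ≤ √(n : ℝ) * (|scaledSpin (x * Function.extend i t 1) - scaledSpin x| * q *
          ((1 + 2 * (k : ℝ)) * (1 + |scaledSpin x|)) ^ q) := by
        gcongr
        exact abs_pow_sub_pow_le_of_le q h1 h2 h3
    _ = |flipSum i x t| * (q * (1 + 2 * (k : ℝ)) ^ q * (1 + |scaledSpin x|) ^ q) := by
        rw [scaledSpin_mul_extend hi, sub_sub_cancel_left, abs_neg, abs_div, abs_of_pos hn',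
          mul_pow]
        field_simp
    _ ≤ _ := by
        gcongr
        exact abs_flipSum_le i x t

/-- The linearization of the signal phase. -/
def linearPhase (q : ℕ) {n k : ℕ} (γ L : ℝ) (i : Fin k → Fin n) (x : Spins n) (t : Spins k) : ℝ :=
  -(γ * L * q * scaledSpin x ^ (q - 1) * flipSum i x t)

/-- Two sources of error: the Taylor remainder of the `q`-th power, of relative size `1/√n`, and the
replacement of the coefficient `c` by `γ' * L`. -/
lemma abs_signalPhase_sub_le {q n k : ℕ} (hq : 1 ≤ q) (hn : 0 < n) (lam γ c : ℝ)
    {i : Fin k → Fin n} (hi : Function.Injective i) (x : Spins n) (t : Spins k) (γ' L : ℝ)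
    (hc : c = γ * (lam / (n : ℝ) ^ (((q : ℝ) - 1) / 2))) :
    |signalPhase q lam γ x (Function.extend i t 1) - linearPhase q γ' L i x t| ≤
      (|c| * (q ^ 2 * (2 * k) ^ 2 / √(n : ℝ)) + |c - γ' * L| * (q * (2 * k))) *
        ((1 + 2 * (k : ℝ)) ^ q * (1 + |scaledSpin x|) ^ q) := by
  obtain ⟨h1, h2, h3⟩ := abs_scaledSpin_extend_le hn hi x t
  have hn' : (0 : ℝ) < √(n : ℝ) := Real.sqrt_pos.2 (by exact_mod_cast hn)
  have hf := (abs_flipSum_le i x t).trans (flipCount_le t)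
  set s := scaledSpin x with hs
  set b := flipSum i x t with hb
  set B := (1 + 2 * (k : ℝ)) * (1 + |s|) with hB
  have h4 := abs_pow_sub_pow_add_le q h1 h2 h3
  rw [scaledSpin_mul_extend hi, ← hs, ← hb, sub_sub_cancel] at h4
  have h5 : signalPhase q lam γ x (Function.extend i t 1) - linearPhase q γ' L i x t =
      c * (√(n : ℝ) * ((s - b / √(n : ℝ)) ^ q - s ^ q + q * (b / √(n : ℝ)) * s ^ (q - 1))) -
        (c - γ' * L) * (q * b * s ^ (q - 1)) := by
    rw [signalPhase_eq hq hn, scaledSpin_mul_extend hi, linearPhase, ← hs, ← hb, ← hc]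
    field_simp
    ring
  have h6 : |s ^ (q - 1)| ≤ B ^ q := by
    rw [abs_pow]
    calc |s| ^ (q - 1) ≤ B ^ (q - 1) := by gcongr
      _ ≤ B ^ q := pow_le_pow_right₀ h1 (Nat.sub_le _ _)
  have hBq : 0 ≤ B ^ q := by positivity
  rw [h5, ← mul_pow (1 + 2 * (k : ℝ)), ← hB]
  calc _ ≤ |c| * (√(n : ℝ) * |(s - b / √(n : ℝ)) ^ q - s ^ q +
            q * (b / √(n : ℝ)) * s ^ (q - 1)|) + |c - γ' * L| * (q * |b| * |s ^ (q - 1)|) := by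
        refine (abs_sub _ _).trans_eq ?_
        simp only [abs_mul, abs_of_pos hn', Nat.abs_cast]
    _ ≤ |c| * (√(n : ℝ) * (q ^ 2 * (b / √(n : ℝ)) ^ 2 * B ^ q)) +
          |c - γ' * L| * (q * (2 * k) * B ^ q) := by gcongr
    _ = |c| * (q ^ 2 * |b| ^ 2 / √(n : ℝ) * B ^ q) + |c - γ' * L| * (q * (2 * k) * B ^ q) := by
        rw [sq_abs]
        field_simp
    _ ≤ |c| * (q ^ 2 * (2 * k) ^ 2 / √(n : ℝ) * B ^ q) +
          |c - γ' * L| * (q * (2 * k) * B ^ q) := by gcongr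
    _ = _ := by ring

lemma noiseDamp_nonneg (q n : ℕ) {k : ℕ} (γ : ℝ) (t : Spins k) : 0 ≤ noiseDamp q n γ t :=
  (Real.exp_pos _).le

lemma mul_exp_neg_sq_le_one (y : ℝ) : y * Real.exp (-y ^ 2) ≤ 1 := by
  have h := Real.add_one_le_exp (y ^ 2)
  rw [Real.exp_neg, ← div_eq_mul_inv, div_le_one (Real.exp_pos _)]
  nlinarith [sq_nonneg (y - 1)]

/-- The noise suppresses large phases. -/
lemma abs_mul_noiseDamp_le {q n k : ℕ} (hq : 1 ≤ q) (hn : 0 < n) (hkn : 2 * k ≤ n) (γ : ℝ)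
    (t : Spins k) : |γ| * flipCount t * noiseDamp q n γ t ≤ 1 + 2 * k := by
  have hn' : (0 : ℝ) < n := by exact_mod_cast hn
  have h0 := flipCount_nonneg t
  have h1 := flipCount_le t
  have hkn' : (2 * k : ℝ) ≤ n := by exact_mod_cast hkn
  set e := flipCount t with he
  -- A number in `[0, 1]` dominates its `q`-th power; `2 * k ≤ n` keeps `1 - e / n` in that
  -- interval.
  have h2 : e ≤ n * (1 - (1 - e / n) ^ q) := by
    have h3 : (1 - e / n) ^ q ≤ 1 - e / n := by
      refine pow_le_of_le_one ?_ ?_ (by omega)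
      · rw [sub_nonneg, div_le_one hn']
        linarith
      · have : 0 ≤ e / n := by positivity
        linarith
    calc e = n * (1 - (1 - e / n)) := by field_simp; ring
      _ ≤ _ := by gcongr
  have h4 : noiseDamp q n γ t ≤ Real.exp (-(|γ| * √e) ^ 2) := by
    unfold noiseDamp
    rw [← he, mul_pow, sq_abs, Real.sq_sqrt h0]
    gcongr
  have h5 : √e ≤ 1 + 2 * k := by
    rw [Real.sqrt_le_left (by positivity)]
    nlinarith
  -- One factor `√e` of `e` joins `|γ|`, where `y e^{-y²} ≤ 1` applies with `y = |γ| √e`; the other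
  -- stays bounded by the number of sites.
  calc |γ| * e * noiseDamp q n γ t ≤ |γ| * e * Real.exp (-(|γ| * √e) ^ 2) := by gcongr
    _ = √e * ((|γ| * √e) * Real.exp (-(|γ| * √e) ^ 2)) := by
        nth_rw 1 [← Real.mul_self_sqrt h0]
        ring
    _ ≤ √e * 1 := by
        gcongr
        exact mul_exp_neg_sq_le_one _
    _ ≤ _ := by linarith

lemma tendsto_noiseDamp (q : ℕ) {k : ℕ} {γs : ℕ → ℝ} {γ : ℝ} (hγ : Tendsto γs atTop (𝓝 γ))
    (t : Spins k) : Tendsto (fun n : ℕ => noiseDamp q n (γs n) t) atTop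
      (𝓝 (Real.exp (-(γ ^ 2 * (q * flipCount t))))) := by
  have h0 := flipCount_nonneg t
  set e := flipCount t with he
  -- First-order expansion of the `q`-th power at `1`; the remainder is `O(1/n)`.
  have h1 : Tendsto (fun n : ℕ => (n : ℝ) * (1 - (1 - e / n) ^ q)) atTop (𝓝 (q * e)) := by
    rw [tendsto_iff_norm_sub_tendsto_zero]
    refine squeeze_zero' (Eventually.of_forall fun _ => norm_nonneg _) ?_
      (tendsto_const_div_atTop_nhds_zero_nat (q ^ 2 * e ^ 2 * (1 + e) ^ q))
    filter_upwards [eventually_gt_atTop 0] with n hn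
    have hn' : (1 : ℝ) ≤ n := by exact_mod_cast hn
    have h2 : 0 ≤ e / n := by positivity
    have h3 : e / n ≤ e := div_le_self h0 hn'
    have h4 := abs_pow_sub_pow_add_le (s := 1) (r := 1 - e / n) (B := 1 + e) q (by linarith)
      (by rw [abs_one]; linarith) (abs_le.2 ⟨by linarith, by linarith⟩)
    rw [sub_sub_cancel, one_pow, one_pow, mul_one] at h4
    have h5 : (n : ℝ) * (1 - (1 - e / n) ^ q) - q * e =
        -(n * ((1 - e / n) ^ q - 1 + q * (e / n))) := by
      field_simp
      ring
    rw [h5, norm_neg, norm_mul, Real.norm_eq_abs, Real.norm_eq_abs, Nat.abs_cast]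
    calc _ ≤ (n : ℝ) * (q ^ 2 * (e / n) ^ 2 * (1 + e) ^ q) := by gcongr
      _ = _ := by field_simp
  unfold noiseDamp
  exact (Real.continuous_exp.tendsto _).comp ((hγ.pow 2).mul h1).neg

/-! ### The moments of the overlap -/

/-- The overlap in the limit, as a function of the normalized total spin. -/
def limitOverlap (q : ℕ) (γ β L s : ℝ) : ℝ :=
  Real.exp (-2 * q * γ ^ 2) * Real.sin (2 * β) * Real.sin (2 * q * L * γ * s ^ (q - 1))

lemma continuous_limitOverlap (q : ℕ) (γ β L : ℝ) : Continuous (limitOverlap q γ β L) := by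
  unfold limitOverlap
  fun_prop

lemma exp_neg_le_one (q : ℕ) (γ : ℝ) : Real.exp (-2 * q * γ ^ 2) ≤ 1 := by
  rw [Real.exp_le_one_iff]
  have : (0 : ℝ) ≤ q * γ ^ 2 := by positivity
  linarith

lemma abs_limitOverlap_le (q : ℕ) (γ β L s : ℝ) : |limitOverlap q γ β L s| ≤ 1 := by
  rw [limitOverlap, abs_mul, abs_mul, abs_of_pos (Real.exp_pos _)]
  exact mul_le_one₀ (mul_le_one₀ (exp_neg_le_one q γ) (abs_nonneg _) (Real.abs_sin_le_one _))
    (abs_nonneg _) (Real.abs_sin_le_one _)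

/-- The coefficient of a single spin in the linearized averages. -/
def spinCoeff (q : ℕ) (γ β L s : ℝ) : ℂ :=
  Complex.cos (2 * β) + Complex.I * ((Real.exp (-2 * q * γ ^ 2) * Real.sin (2 * β) *
    Real.cos (2 * q * L * γ * s ^ (q - 1)) : ℝ) : ℂ)

lemma norm_spinCoeff_le (q : ℕ) (γ β L s : ℝ) : ‖spinCoeff q γ β L s‖ ≤ 2 := by
  refine (norm_add_le _ _).trans ?_
  rw [norm_mul, Complex.norm_I, one_mul, Complex.norm_real, Real.norm_eq_abs]
  have h1 : ‖Complex.cos (2 * β)‖ ≤ 1 := by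
    simpa [flipAmp] using norm_flipAmp_le β 1
  have h2 : |Real.exp (-2 * q * γ ^ 2) * Real.sin (2 * β) *
      Real.cos (2 * q * L * γ * s ^ (q - 1))| ≤ 1 := by
    rw [abs_mul, abs_mul, abs_of_pos (Real.exp_pos _)]
    exact mul_le_one₀ (mul_le_one₀ (exp_neg_le_one q γ) (abs_nonneg _) (Real.abs_sin_le_one _))
      (abs_nonneg _) (Real.abs_cos_le_one _)
  linarith

/-- The weight of the flips `t` in the limit. -/
def limitWeight (q : ℕ) {k : ℕ} (γ β : ℝ) (t : Spins k) : ℂ :=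
  (∏ l, flipAmp β (t l)) * (Real.exp (-(γ ^ 2 * (q * flipCount t))) : ℝ)

lemma norm_limitWeight_le (q : ℕ) {k : ℕ} (γ β : ℝ) (t : Spins k) :
    ‖limitWeight q γ β t‖ ≤ 1 := by
  rw [limitWeight, norm_mul, Complex.norm_real, Real.norm_eq_abs, abs_of_pos (Real.exp_pos _)]
  refine mul_le_one₀ (norm_prod_flipAmp_le β t) (Real.exp_pos _).le ?_
  rw [Real.exp_le_one_iff]
  have := flipCount_nonneg t
  have : 0 ≤ γ ^ 2 * (q * flipCount t) := by positivity
  linarith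

/-- The linearization of `pairTerm`. -/
def linearTerm (q : ℕ) {n k : ℕ} (γ β L : ℝ) (i : Fin k → Fin n) (x : Spins n) (t : Spins k) : ℂ :=
  (∏ l, (val (x (i l)) : ℂ)) * (limitWeight q γ β t *
    Complex.exp (Complex.I * linearPhase q γ L i x t))

lemma norm_linearTerm_le (q : ℕ) {n k : ℕ} (γ β L : ℝ) (i : Fin k → Fin n) (x : Spins n)
    (t : Spins k) : ‖linearTerm q γ β L i x t‖ ≤ 1 := by
  rw [linearTerm, norm_mul, norm_mul, norm_prod_val, norm_exp_I_mul_ofReal, one_mul, mul_one]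
  exact norm_limitWeight_le q γ β t

lemma norm_expect_sum_le {n k : ℕ} {f : Spins n → Spins k → ℂ} {g : Spins n → Spins k → ℝ}
    (h : ∀ x t, ‖f x t‖ ≤ g x t) : ‖𝔼 x, ∑ t, f x t‖ ≤ 𝔼 x, ∑ t, g x t :=
  (RCLike.norm_expect_le (K := ℂ)).trans <| Finset.expect_le_expect fun x _ =>
    (norm_sum_le _ _).trans <| Finset.sum_le_sum fun t _ => h x t

/-- Both `flipCount` and the linearized phase are additive over the chosen sites, so the sum over
`t` is a product of two-term sums. Leaving site `l` alone gives `x cos 2β`; flipping it gives `i sin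
2β e^{-2qγ²} x e^{-ixθ}`, and `x = ±1` gives `x e^{-ixθ} = x cos θ - i sin θ`. The `sin θ` part is
free of `x` and becomes `limitOverlap`. -/
lemma sum_linearTerm (q : ℕ) {n k : ℕ} (γ β L : ℝ) (i : Fin k → Fin n) (x : Spins n) :
    ∑ t, linearTerm q γ β L i x t = ∏ l, ((val (x (i l)) : ℂ) *
      spinCoeff q γ β L (scaledSpin x) + limitOverlap q γ β L (scaledSpin x)) := by
  set s := scaledSpin x with hs
  set f : Fin k → ℤˣ → ℂ := fun l t => (val (x (i l)) : ℂ) * (flipAmp β t *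
    ((Real.exp (-(γ ^ 2 * (q * (1 - val t)))) : ℝ) : ℂ) *
    Complex.exp (Complex.I * ((-(γ * L * q * s ^ (q - 1) * (val (x (i l)) * (1 - val t))) : ℝ) : ℂ)))
    with hf
  have h1 : ∀ t : Spins k, linearTerm q γ β L i x t = ∏ l, f l (t l) := by
    intro t
    simp only [hf, Finset.prod_mul_distrib, linearTerm, limitWeight]
    congr 2
    · congr 1
      rw [← Complex.ofReal_prod, ← Real.exp_sum, Finset.sum_neg_distrib, flipCount,
        Finset.mul_sum, Finset.mul_sum]
    · rw [← Complex.exp_sum, ← Finset.mul_sum, ← Complex.ofReal_sum, Finset.sum_neg_distrib,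
        ← Finset.mul_sum, linearPhase, flipSum]
  have h2 := Finset.prod_univ_sum (fun _ : Fin k => (Finset.univ : Finset ℤˣ)) f
  rw [Fintype.piFinset_univ] at h2
  simp only [h1]
  rw [← h2]
  refine Finset.prod_congr rfl fun l _ => ?_
  rw [sum_sign]
  have hexp : -(γ ^ 2 * (q * (1 - val (-1)))) = -2 * q * γ ^ 2 := by
    rw [val_neg_one]
    ring
  simp only [hf, hexp, spinCoeff, limitOverlap]
  set θ := 2 * q * L * γ * s ^ (q - 1) with hθ
  have h3 : ∀ a : ℝ, -(γ * L * q * s ^ (q - 1) * (a * (1 - val (-1)))) = -(a * θ) := by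
    intro a
    rw [val_neg_one, hθ]
    ring
  simp only [h3]
  have h4 : ∀ a : ℤˣ, (val a : ℂ) * Complex.exp (Complex.I * ((-(val a * θ) : ℝ) : ℂ)) =
      val a * Complex.cos θ - Complex.I * Complex.sin θ := by
    intro a
    revert a
    refine forall_sign ?_ ?_
    · rw [mul_comm Complex.I, Complex.exp_mul_I]
      simp
      ring
    · rw [mul_comm Complex.I, Complex.exp_mul_I]
      simp
      ring
  have h5 := h4 (x (i l))
  simp only [flipAmp, if_neg neg_one_ne_one_sign, if_true, val_one, sub_self, mul_zero, neg_zero,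
    Real.exp_zero, Complex.ofReal_one, Complex.ofReal_zero, Complex.exp_zero, mul_one]
  push_cast at h5 ⊢
  linear_combination Complex.I * Complex.sin (2 * β) * Complex.exp (-2 * q * γ ^ 2) * h5 -
    Complex.sin (2 * β) * Complex.exp (-2 * q * γ ^ 2) * Complex.sin θ * Complex.I_sq

/-- For fixed `x` the average over all tuples, repetitions included, of a product over sites is the
`k`-th power of the one-site average. -/
lemma expect_linearTerm {n : ℕ} (hn : 0 < n) (q k : ℕ) (γ β L : ℝ) :
    𝔼 i : Fin k → Fin n, 𝔼 x : Spins n, ∑ t, linearTerm q γ β L i x t =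
      𝔼 x : Spins n, (((spinSum x / n : ℝ) : ℂ) * spinCoeff q γ β L (scaledSpin x) +
        limitOverlap q γ β L (scaledSpin x)) ^ k := by
  have : Nonempty (Fin n) := ⟨⟨0, hn⟩⟩
  rw [Finset.expect_comm]
  refine Finset.expect_congr rfl fun x _ => ?_
  simp only [sum_linearTerm]
  have h : ((spinSum x / n : ℝ) : ℂ) * spinCoeff q γ β L (scaledSpin x) +
        limitOverlap q γ β L (scaledSpin x) = 𝔼 j : Fin n, ((val (x j) : ℂ) *
      spinCoeff q γ β L (scaledSpin x) + limitOverlap q γ β L (scaledSpin x)) := by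
    rw [Finset.expect_add_distrib, Fintype.expect_const, ← Finset.expect_mul,
      Fintype.expect_eq_sum_div_card, spinSum, Fintype.card_fin]
    push_cast
    rfl
  rw [h, Finset.expect_pow, Fintype.piFinset_univ]

lemma norm_pow_sub_pow_le {z w : ℂ} {C : ℝ} (k : ℕ) (hC : 1 ≤ C) (hz : ‖z‖ ≤ C) (hw : ‖w‖ ≤ C) :
    ‖z ^ k - w ^ k‖ ≤ k * C ^ k * ‖z - w‖ := by
  induction k with
  | zero => simp
  | succ k ih =>
    have h : z ^ (k + 1) - w ^ (k + 1) = z * (z ^ k - w ^ k) + (z - w) * w ^ k := by ring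
    have hC0 : 0 ≤ C := by linarith
    rw [h]
    calc _ ≤ ‖z‖ * ‖z ^ k - w ^ k‖ + ‖z - w‖ * ‖w‖ ^ k := by
          rw [← norm_mul, ← norm_pow, ← norm_mul]
          exact norm_add_le _ _
      _ ≤ C * (k * C ^ k * ‖z - w‖) + ‖z - w‖ * C ^ (k + 1) := by
          gcongr
          exact (pow_le_pow_left₀ (norm_nonneg _) hw k).trans
            (pow_le_pow_right₀ hC (Nat.le_succ k))
      _ = _ := by
          push_cast
          ring

/-- The linearized averages converge to the moments of the limit law. -/
lemma tendsto_expect_linearTerm (q k : ℕ) (γ β L : ℝ) :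
    Tendsto (fun n : ℕ => 𝔼 i : Fin k → Fin n, 𝔼 x : Spins n, ∑ t, linearTerm q γ β L i x t) atTop
      (𝓝 ((∫ g, limitOverlap q γ β L g ^ k ∂(gaussianReal 0 1) : ℝ) : ℂ)) := by
  have h1 : Tendsto (fun n : ℕ => ((𝔼 x : Spins n, limitOverlap q γ β L (scaledSpin x) ^ k : ℝ) : ℂ))
      atTop (𝓝 ((∫ g, limitOverlap q γ β L g ^ k ∂(gaussianReal 0 1) : ℝ) : ℂ)) := by
    refine (Complex.continuous_ofReal.tendsto _).comp ?_
    refine tendsto_expect_scaledSpin (f := fun s => limitOverlap q γ β L s ^ k)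
      ((continuous_limitOverlap q γ β L).pow k) (C := 1) fun s => ?_
    rw [abs_pow]
    exact pow_le_one₀ (abs_nonneg _) (abs_limitOverlap_le q γ β L s)
  obtain ⟨M, hM0, hM⟩ := exists_expect_scaledSpin_le 1
  have h2 : Tendsto (fun n : ℕ => 𝔼 i : Fin k → Fin n, 𝔼 x : Spins n,
      ∑ t, linearTerm q γ β L i x t -
        ((𝔼 x : Spins n, limitOverlap q γ β L (scaledSpin x) ^ k : ℝ) : ℂ)) atTop (𝓝 0) := by
    have hlim : Tendsto (fun n : ℕ => k * 3 ^ k * (2 * M) * (√(n : ℝ))⁻¹) atTop (𝓝 0) := by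
      have := (tendsto_inv_atTop_zero.comp
        (Real.tendsto_sqrt_atTop.comp tendsto_natCast_atTop_atTop)).const_mul
          ((k : ℝ) * 3 ^ k * (2 * M))
      simpa using this
    refine squeeze_zero_norm' ?_ hlim
    filter_upwards [eventually_gt_atTop 0] with n hn
    have hn' : (0 : ℝ) < n := by exact_mod_cast hn
    have hs0 : 0 < √(n : ℝ) := Real.sqrt_pos.2 hn'
    have hcast : ((𝔼 x : Spins n, limitOverlap q γ β L (scaledSpin x) ^ k : ℝ) : ℂ) =
        𝔼 x : Spins n, (limitOverlap q γ β L (scaledSpin x) : ℂ) ^ k := by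
      rw [Fintype.expect_eq_sum_div_card, Fintype.expect_eq_sum_div_card]
      push_cast
      rfl
    rw [expect_linearTerm hn, hcast, ← Finset.expect_sub_distrib]
    -- The magnetization per site is `s/√n`, so removing the `spinCoeff` term costs `O(|s|/√n)`. The
    -- constant `3` bounds both bases: `1 * 2` from the `spinCoeff` term plus `1` from
    -- `limitOverlap`.
    calc _ ≤ 𝔼 x : Spins n, (k : ℝ) * 3 ^ k * (2 * (1 + |scaledSpin x|) ^ 1) * (√(n : ℝ))⁻¹ := by
          refine (RCLike.norm_expect_le (K := ℂ)).trans (Finset.expect_le_expect fun x _ => ?_)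
          have hA := norm_spinCoeff_le q γ β L (scaledSpin x)
          have hB : ‖(limitOverlap q γ β L (scaledSpin x) : ℂ)‖ ≤ 1 := by
            rw [Complex.norm_real]
            exact abs_limitOverlap_le q γ β L _
          have hx : ‖((spinSum x / n : ℝ) : ℂ)‖ = |scaledSpin x| * (√(n : ℝ))⁻¹ := by
            rw [Complex.norm_real, Real.norm_eq_abs, abs_div, scaledSpin, abs_div,
              abs_of_pos hs0, abs_of_pos hn', ← div_eq_mul_inv, div_div, Real.mul_self_sqrt hn'.le]
          have hx1 : ‖((spinSum x / n : ℝ) : ℂ)‖ ≤ 1 := by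
            rw [Complex.norm_real, Real.norm_eq_abs, abs_div, abs_of_pos hn', div_le_one hn']
            refine (Finset.abs_sum_le_sum_abs _ _).trans ?_
            simp [abs_val]
          have hz : ‖((spinSum x / n : ℝ) : ℂ) * spinCoeff q γ β L (scaledSpin x)‖ ≤
              ‖((spinSum x / n : ℝ) : ℂ)‖ * 2 := by
            rw [norm_mul]
            gcongr
          refine (norm_pow_sub_pow_le (C := 3) k (by norm_num)
            ((norm_add_le _ _).trans (by linarith)) (by linarith)).trans ?_
          rw [add_sub_cancel_right]
          calc _ ≤ (k : ℝ) * 3 ^ k * (|scaledSpin x| * (√(n : ℝ))⁻¹ * 2) := by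
                rw [← hx]
                gcongr
            _ = (k : ℝ) * 3 ^ k * (2 * |scaledSpin x|) * (√(n : ℝ))⁻¹ := by ring
            _ ≤ _ := by
                gcongr
                linarith
      _ = (k : ℝ) * 3 ^ k * (2 * 𝔼 x : Spins n, (1 + |scaledSpin x|) ^ 1) * (√(n : ℝ))⁻¹ := by
          rw [← Finset.expect_mul, ← Finset.mul_expect, ← Finset.mul_expect]
      _ ≤ _ := by
          gcongr
          exact hM n
  simpa using h2.add h1

/-- The averaged correlations are asymptotic to the linearized ones. -/
lemma tendsto_expect_meanCorr_sub {q : ℕ} (hq : 1 ≤ q) (k : ℕ) {γs βs lam : ℕ → ℝ} {γ β L : ℝ}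
    (hγ : Tendsto γs atTop (𝓝 γ)) (hβ : Tendsto βs atTop (𝓝 β))
    (hL : Tendsto (fun n : ℕ => lam n / (n : ℝ) ^ (((q : ℝ) - 1) / 2)) atTop (𝓝 L)) :
    Tendsto (fun n : ℕ => 𝔼 i : Fin k → Fin n, (meanCorr q (lam n) (γs n) (βs n) i : ℂ) -
      𝔼 i : Fin k → Fin n, 𝔼 x : Spins n, ∑ t, linearTerm q γ β L i x t) atTop (𝓝 0) := by
  obtain ⟨M, hM0, hM⟩ := exists_expect_scaledSpin_le q
  set c : ℕ → ℝ := fun n => γs n * (lam n / (n : ℝ) ^ (((q : ℝ) - 1) / 2)) with hc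
  set w : ℕ → Spins k → ℂ := fun n t =>
    (∏ l, flipAmp (βs n) (t l)) * (noiseDamp q n (γs n) t : ℂ) with hw
  set K : ℕ → ℝ := fun n => |c n| * (q ^ 2 * (2 * k) ^ 2 / √(n : ℝ)) +
    |c n - γ * L| * (q * (2 * k)) with hK
  have hcard : (Fintype.card (Spins k) : ℝ) = 2 ^ k := by simp
  have hcl : Tendsto c atTop (𝓝 (γ * L)) := hγ.mul hL
  have hKl : Tendsto K atTop (𝓝 0) := by
    have h1 : Tendsto (fun n : ℕ => (q : ℝ) ^ 2 * (2 * k) ^ 2 / √(n : ℝ)) atTop (𝓝 0) :=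
      (Real.tendsto_sqrt_atTop.comp tendsto_natCast_atTop_atTop).const_div_atTop _
    have h2 : Tendsto (fun n => |c n - γ * L|) atTop (𝓝 0) := by
      simpa using (hcl.sub_const (γ * L)).abs
    simpa using (hcl.abs.mul h1).add (h2.mul_const ((q : ℝ) * (2 * k)))
  have hwl : ∀ t, Tendsto (fun n => w n t) atTop (𝓝 (limitWeight q γ β t)) := by
    intro t
    refine Tendsto.mul (tendsto_finsetProd _ fun l _ => ?_)
      ((Complex.continuous_ofReal.tendsto _).comp (tendsto_noiseDamp q hγ t))
    have hβ' : Tendsto (fun n => (βs n : ℂ)) atTop (𝓝 β) :=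
      (Complex.continuous_ofReal.tendsto _).comp hβ
    unfold flipAmp
    split_ifs
    · exact (Complex.continuous_cos.tendsto _).comp (hβ'.const_mul 2)
    · exact ((Complex.continuous_sin.tendsto _).comp (hβ'.const_mul 2)).const_mul _
  -- There are `2 ^ k` flip patterns, each linear term having norm at most one. In `ε`, the first
  -- sum is the error of the weights and the second that of the phases, averaged over `x`.
  refine tendsto_expect_sub_of_injective (C := 2 ^ k)
    (ε := fun n => ∑ t : Spins k, ‖w n t - limitWeight q γ β t‖ +
      2 ^ k * (K n * ((1 + 2 * (k : ℝ)) ^ q * M)))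
    (fun n i => ?_) (fun n i => ?_) ?_ ?_
  · rw [Complex.norm_real]
    exact (abs_meanCorr_le q _ _ _ i).trans (one_le_pow₀ (by norm_num))
  · refine (norm_expect_sum_le fun x t => norm_linearTerm_le q γ β L i x t).trans ?_
    rw [Fintype.expect_const]
    simp
  · have h1 : Tendsto (fun n => ∑ t : Spins k, ‖w n t - limitWeight q γ β t‖) atTop (𝓝 0) := by
      have := tendsto_finsetSum (Finset.univ : Finset (Spins k)) fun t _ =>
        ((hwl t).sub_const (limitWeight q γ β t)).norm
      simpa using this
    simpa using h1.add ((hKl.mul_const ((1 + 2 * (k : ℝ)) ^ q * M)).const_mul (2 ^ k))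
  · filter_upwards [eventually_gt_atTop 0] with n hn i hi
    have hK0 : 0 ≤ K n := by positivity
    rw [meanCorr_eq hq hn _ _ _ hi, ← Finset.expect_sub_distrib]
    simp only [← Finset.sum_sub_distrib]
    refine (norm_expect_sum_le (g := fun x t => ‖w n t - limitWeight q γ β t‖ +
      K n * ((1 + 2 * (k : ℝ)) ^ q * (1 + |scaledSpin x|) ^ q)) fun x t => ?_).trans ?_
    · rw [pairTerm_eq hq hn _ _ _ hi, linearTerm, ← mul_sub, norm_mul, norm_prod_val, one_mul]
      have h1 := norm_exp_sub_exp_le (signalPhase q (lam n) (γs n) x (Function.extend i t 1))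
        (linearPhase q γ L i x t)
      have h2 := abs_signalPhase_sub_le hq hn (lam n) (γs n) (c n) hi x t γ L rfl
      have h3 := norm_limitWeight_le q γ β t
      set e₁ := Complex.exp (Complex.I *
        (signalPhase q (lam n) (γs n) x (Function.extend i t 1) : ℝ)) with he₁
      set e₂ := Complex.exp (Complex.I * (linearPhase q γ L i x t : ℝ))
      have h4 : ‖e₁‖ = 1 := norm_exp_I_mul_ofReal _
      have h5 : w n t * e₁ - limitWeight q γ β t * e₂ =
          (w n t - limitWeight q γ β t) * e₁ + limitWeight q γ β t * (e₁ - e₂) := by ring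
      calc ‖w n t * e₁ - limitWeight q γ β t * e₂‖
          ≤ ‖w n t - limitWeight q γ β t‖ * ‖e₁‖ + ‖limitWeight q γ β t‖ * ‖e₁ - e₂‖ := by
            rw [h5, ← norm_mul, ← norm_mul]
            exact norm_add_le _ _
        _ ≤ ‖w n t - limitWeight q γ β t‖ * 1 + 1 *
            (K n * ((1 + 2 * (k : ℝ)) ^ q * (1 + |scaledSpin x|) ^ q)) := by
            rw [h4]
            gcongr
            exact h1.trans h2
        _ = _ := by ring
    · simp only [Finset.sum_add_distrib, Finset.sum_const, Finset.card_univ, nsmul_eq_mul, hcard]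
      rw [Finset.expect_add_distrib, Fintype.expect_const, ← Finset.mul_expect,
        ← Finset.mul_expect, ← Finset.mul_expect]
      gcongr
      exact hM n

lemma tendsto_integral_overlap_pow {q : ℕ} (hq : 1 ≤ q) (k : ℕ) {γs βs lam : ℕ → ℝ} {γ β L : ℝ}
    (hγ : Tendsto γs atTop (𝓝 γ)) (hβ : Tendsto βs atTop (𝓝 β))
    (hL : Tendsto (fun n : ℕ => lam n / (n : ℝ) ^ (((q : ℝ) - 1) / 2)) atTop (𝓝 L)) :
    Tendsto (fun n : ℕ => ∫ ω, overlapRV q n ω ^ k ∂(jointLaw q n (lam n) (γs n) (βs n))) atTop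
      (𝓝 (∫ g, limitOverlap q γ β L g ^ k ∂(gaussianReal 0 1))) := by
  have h := (tendsto_expect_meanCorr_sub hq k hγ hβ hL).add (tendsto_expect_linearTerm q k γ β L)
  simp only [sub_add_cancel, zero_add] at h
  have h' := (Complex.continuous_re.tendsto _).comp h
  rw [Complex.ofReal_re] at h'
  refine h'.congr fun n => ?_
  rw [integral_overlap_pow, Function.comp_apply, Fintype.expect_eq_sum_div_card,
    Fintype.expect_eq_sum_div_card, ← Complex.ofReal_sum, ← Complex.ofReal_natCast,
    ← Complex.ofReal_div, Complex.ofReal_re]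

/-! ### Below the threshold -/

/-- Flipping the spin at `a` alone is a bijection that changes the sign of the product. -/
lemma expect_val_mul_val {n : ℕ} {a b : Fin n} (hab : a ≠ b) :
    𝔼 x : Spins n, (val (x a) : ℂ) * val (x b) = 0 := by
  set m : Spins n := Pi.mulSingle a (-1) with hm
  have ha : ∀ x : Spins n, val ((m * x) a) = -val (x a) := fun x => by
    simp [hm, val]
  have hb : ∀ x : Spins n, val ((m * x) b) = val (x b) := fun x => by
    simp [hm, Pi.mulSingle_eq_of_ne hab.symm]
  have h := Fintype.expect_equiv (Equiv.mulLeft m)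
    (fun x : Spins n => -((val (x a) : ℂ) * val (x b))) (fun x => (val (x a) : ℂ) * val (x b))
    fun x => by
      rw [Equiv.coe_mulLeft, ha, hb]
      push_cast
      ring
  rw [Finset.expect_neg_distrib] at h
  exact self_eq_neg.1 h.symm

/-- Subtracting the terms with phase factor `1`, whose average over `x` is zero, leaves `e^{iφ} - 1`
with `|e^{iφ} - 1| ≤ |φ|`. The damping then removes `|γ|`, so the bound is uniform in `γ` and `β`.
With `k = 2`, the `5` is `1 + 2k`, the leading `4` counts flip patterns, and `4 ≤ n` is `2k ≤ n`. -/
lemma norm_meanCorr_le {q n : ℕ} (hq : 1 ≤ q) (hn : 4 ≤ n) (lam γ β : ℝ) {i : Fin 2 → Fin n}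
    (hi : Function.Injective i) {M : ℝ} (hM : 𝔼 x : Spins n, (1 + |scaledSpin x|) ^ q ≤ M) :
    ‖(meanCorr q lam γ β i : ℂ)‖ ≤
      4 * (|lam / (n : ℝ) ^ (((q : ℝ) - 1) / 2)| * (5 * (q * 5 ^ q * M))) := by
  have hn0 : 0 < n := by omega
  set r := |lam / (n : ℝ) ^ (((q : ℝ) - 1) / 2)| with hr
  set w : Spins 2 → ℂ := fun t => (∏ l, flipAmp β (t l)) * (noiseDamp q n γ t : ℂ) with hw
  have h0 : 𝔼 x : Spins n, ∑ t : Spins 2, (∏ l, (val (x (i l)) : ℂ)) * w t = 0 := by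
    simp only [← Finset.mul_sum, ← Finset.expect_mul, Fin.prod_univ_two]
    rw [expect_val_mul_val (hi.ne (by decide)), zero_mul]
  have h1 : (meanCorr q lam γ β i : ℂ) = 𝔼 x : Spins n, ∑ t : Spins 2,
      (pairTerm q lam γ β i x t - (∏ l, (val (x (i l)) : ℂ)) * w t) := by
    simp only [Finset.sum_sub_distrib]
    rw [Finset.expect_sub_distrib, h0, sub_zero, meanCorr_eq hq hn0 _ _ _ hi]
  rw [h1]
  refine (norm_expect_sum_le (g := fun x _ =>
    r * (5 * (q * 5 ^ q * (1 + |scaledSpin x|) ^ q))) fun x t => ?_).trans ?_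
  · have h2 := norm_exp_sub_exp_le (signalPhase q lam γ x (Function.extend i t 1)) 0
    have h3 := abs_signalPhase_le hq hn0 lam γ hi x t
    have h4 := abs_mul_noiseDamp_le hq hn0 (k := 2) (by omega) γ t
    have h5 := norm_prod_flipAmp_le β t
    have h6 := noiseDamp_nonneg q n γ t
    rw [Complex.ofReal_zero, mul_zero, Complex.exp_zero, sub_zero] at h2
    rw [← hr] at h3
    norm_num at h3 h4
    set e := Complex.exp (Complex.I * (signalPhase q lam γ x (Function.extend i t 1) : ℝ)) with he
    have h7 : pairTerm q lam γ β i x t - (∏ l, (val (x (i l)) : ℂ)) * w t =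
        (∏ l, (val (x (i l)) : ℂ)) * ((∏ l, flipAmp β (t l)) * (noiseDamp q n γ t * (e - 1))) := by
      rw [pairTerm_eq hq hn0 _ _ _ hi]
      ring
    have h8 : 0 ≤ r := abs_nonneg _
    rw [h7, norm_mul, norm_prod_val, one_mul, norm_mul, norm_mul, Complex.norm_real,
      Real.norm_eq_abs, abs_of_nonneg h6]
    calc _ ≤ 1 * (noiseDamp q n γ t * (|γ| * r * (flipCount t *
            (q * 5 ^ q * (1 + |scaledSpin x|) ^ q)))) := by
          gcongr
          exact h2.trans h3
      _ = r * ((|γ| * flipCount t * noiseDamp q n γ t) *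
            (q * 5 ^ q * (1 + |scaledSpin x|) ^ q)) := by ring
      _ ≤ _ := by gcongr
  · simp only [Finset.sum_const, Finset.card_univ, nsmul_eq_mul]
    rw [← Finset.mul_expect, ← Finset.mul_expect, ← Finset.mul_expect, ← Finset.mul_expect]
    have h8 : 0 ≤ r := abs_nonneg _
    have hcard : (Fintype.card (Spins 2) : ℝ) = 4 := by simp
    rw [hcard]
    gcongr

lemma tendsto_secondMoment_zero {q : ℕ} (hq : 1 ≤ q) (γs βs lam : ℕ → ℝ)
    (hL : Tendsto (fun n : ℕ => lam n / (n : ℝ) ^ (((q : ℝ) - 1) / 2)) atTop (𝓝 0)) :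
    Tendsto (fun n : ℕ => secondMoment q n (lam n) (γs n) (βs n)) atTop (𝓝 0) := by
  obtain ⟨M, -, hM⟩ := exists_expect_scaledSpin_le q
  have h := tendsto_expect_sub_of_injective (k := 2) (C := 1)
    (F := fun n i => (meanCorr q (lam n) (γs n) (βs n) i : ℂ)) (F' := fun _ _ => 0)
    (ε := fun n => 4 * (|lam n / (n : ℝ) ^ (((q : ℝ) - 1) / 2)| * (5 * (q * 5 ^ q * M))))
    (fun n i => by
      rw [Complex.norm_real]
      exact abs_meanCorr_le q _ _ _ i) (by simp)
    (by simpa using (hL.abs.mul_const (5 * (q * 5 ^ q * M))).const_mul 4)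
    (by
      filter_upwards [eventually_ge_atTop 4] with n hn i hi
      rw [sub_zero]
      exact norm_meanCorr_le hq hn _ _ _ hi (hM n))
  simp only [Finset.expect_const_zero, sub_zero] at h
  have h' := (Complex.continuous_re.tendsto _).comp h
  refine h'.congr fun n => ?_
  rw [secondMoment_eq, integral_overlap_pow, Function.comp_apply, Fintype.expect_eq_sum_div_card,
    Fintype.expect_eq_sum_div_card, ← Complex.ofReal_sum, ← Complex.ofReal_natCast,
    ← Complex.ofReal_div, Complex.ofReal_re]

/-! ### Convergence in distribution from convergence of moments -/

lemma integrable_pow_of_abs_le_one {Ω : Type*} [MeasurableSpace Ω] {ν : Measure Ω}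
    [IsProbabilityMeasure ν] {Y : Ω → ℝ} (hY : Measurable Y) (hY1 : ∀ ω, |Y ω| ≤ 1) (k : ℕ) :
    Integrable (fun ω => Y ω ^ k) ν := by
  refine Integrable.of_bound (C := 1) (hY.pow_const k).aestronglyMeasurable
    (ae_of_all _ fun ω => ?_)
  rw [norm_pow]
  exact pow_le_one₀ (norm_nonneg _) (hY1 ω)

lemma integrable_eval {Ω : Type*} [MeasurableSpace Ω] {ν : Measure Ω}
    [IsProbabilityMeasure ν] {Y : Ω → ℝ} (hY : Measurable Y) (hY1 : ∀ ω, |Y ω| ≤ 1)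
    (p : Polynomial ℝ) : Integrable (fun ω => p.eval (Y ω)) ν := by
  simp only [Polynomial.eval_eq_sum_range]
  exact integrable_finsetSum _ fun k _ => (integrable_pow_of_abs_le_one hY hY1 k).const_mul _

lemma integral_eval {Ω : Type*} [MeasurableSpace Ω] {ν : Measure Ω}
    [IsProbabilityMeasure ν] {Y : Ω → ℝ} (hY : Measurable Y) (hY1 : ∀ ω, |Y ω| ≤ 1)
    (p : Polynomial ℝ) : ∫ ω, p.eval (Y ω) ∂ν =
      ∑ k ∈ Finset.range (p.natDegree + 1), p.coeff k * ∫ ω, Y ω ^ k ∂ν := by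
  simp only [Polynomial.eval_eq_sum_range]
  rw [integral_finsetSum _ fun k _ => (integrable_pow_of_abs_le_one hY hY1 k).const_mul _]
  simp only [integral_const_mul]

lemma abs_integral_eval_sub_le {Ω : Type*} [MeasurableSpace Ω] {ν : Measure Ω}
    [IsProbabilityMeasure ν] {Y : Ω → ℝ} (hY : Measurable Y) (hY1 : ∀ ω, |Y ω| ≤ 1)
    {p : Polynomial ℝ} {f : BoundedContinuousFunction ℝ ℝ} {ε : ℝ}
    (hp : ∀ x ∈ Set.Icc (-1 : ℝ) 1, |p.eval x - f x| < ε) :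
    |∫ ω, p.eval (Y ω) ∂ν - ∫ ω, f (Y ω) ∂ν| ≤ ε := by
  have hf : Integrable (fun ω => f (Y ω)) ν :=
    Integrable.of_bound (C := ‖f‖) (f.continuous.measurable.comp hY).aestronglyMeasurable
      (ae_of_all _ fun ω => f.norm_coe_le_norm _)
  rw [← integral_sub (integrable_eval hY hY1 p) hf, ← Real.norm_eq_abs]
  refine (norm_integral_le_of_norm_le_const (C := ε) (ae_of_all _ fun ω => ?_)).trans (by simp)
  exact (hp _ (abs_le.1 (hY1 ω))).le

/-- For random variables bounded by one, convergence of the moments implies convergence in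
distribution. -/
lemma tendstoInDistribution_of_moments {Ω : ℕ → Type*} {Ω' : Type*} [∀ n, MeasurableSpace (Ω n)]
    [MeasurableSpace Ω'] {μ : ∀ n, Measure (Ω n)} [∀ n, IsProbabilityMeasure (μ n)]
    {μ' : Measure Ω'} [IsProbabilityMeasure μ'] {X : ∀ n, Ω n → ℝ} {Z : Ω' → ℝ}
    (hX : ∀ n, Measurable (X n)) (hZ : Measurable Z) (hX1 : ∀ n ω, |X n ω| ≤ 1)
    (hZ1 : ∀ ω, |Z ω| ≤ 1)
    (h : ∀ k : ℕ, Tendsto (fun n => ∫ ω, X n ω ^ k ∂(μ n)) atTop (𝓝 (∫ ω, Z ω ^ k ∂μ'))) :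
    TendstoInDistribution X atTop Z μ μ' := by
  refine ⟨fun n => (hX n).aemeasurable, hZ.aemeasurable, ?_⟩
  refine ProbabilityMeasure.tendsto_iff_forall_integral_tendsto.2 fun f => ?_
  simp only [ProbabilityMeasure.coe_mk]
  rw [integral_map hZ.aemeasurable (by fun_prop)]
  have hmap : ∀ n, ∫ x, f x ∂((μ n).map (X n)) = ∫ ω, f (X n ω) ∂(μ n) := fun n =>
    integral_map (hX n).aemeasurable (by fun_prop)
  simp only [hmap]
  rw [Metric.tendsto_atTop]
  intro ε hε
  -- Weierstrass on `[-1, 1]`, where all the variables live: two approximation errors and one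
  -- difference of polynomial expectations, `ε / 3` each.
  obtain ⟨p, hp⟩ := exists_polynomial_near_of_continuousOn (-1) 1 f f.continuous.continuousOn
    (ε / 3) (by positivity)
  have hlim : Tendsto (fun n => ∫ ω, p.eval (X n ω) ∂(μ n)) atTop
      (𝓝 (∫ ω, p.eval (Z ω) ∂μ')) := by
    simp only [integral_eval (hX _) (hX1 _), integral_eval hZ hZ1]
    exact tendsto_finsetSum _ fun k _ => (h k).const_mul _
  obtain ⟨N, hN⟩ := Metric.tendsto_atTop.1 hlim (ε / 3) (by positivity)
  refine ⟨N, fun n hn => ?_⟩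
  have h1 := abs_le.1 (abs_integral_eval_sub_le (ν := μ n) (hX n) (hX1 n) hp)
  have h2 := abs_le.1 (abs_integral_eval_sub_le (ν := μ') hZ hZ1 hp)
  have h3 := hN n hn
  rw [Real.dist_eq, abs_lt] at h3 ⊢
  constructor <;> linarith [h1.1, h1.2, h2.1, h2.2, h3.1, h3.2]

/-! ### Bounds on the overlap and positivity of the limiting second moment -/

lemma measurable_overlapRV (q n : ℕ) : Measurable (overlapRV q n) := by
  have h : Measurable fun p : Spins n × Spins n => overlap p.1 p.2 := measurable_of_countable _
  exact h.comp (f := fun ω : (Spins n × Tensor q n) × Spins n => (ω.2, ω.1.1)) (by fun_prop)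

lemma abs_overlap_le {n : ℕ} (z u : Spins n) : |overlap z u| ≤ 1 := by
  rw [overlap, abs_mul, abs_of_nonneg (by positivity : 0 ≤ 1 / (n : ℝ))]
  have h : |∑ i, val (z i) * val (u i)| ≤ n := by
    refine (Finset.abs_sum_le_sum_abs _ _).trans ?_
    simp [abs_mul, abs_val]
  rw [one_div_mul_eq_div]
  exact div_le_one_of_le₀ h (by positivity)

/-- A continuous nonnegative function that is nonzero somewhere is nonzero on a nonempty open set,
and the Gaussian charges every such set. -/
lemma integral_limitOverlap_sq_pos {q : ℕ} (hq : 2 ≤ q) {γ β L : ℝ} (hL : 0 < L) (hγ : 0 < γ)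
    (hβ : ∀ k : ℤ, β ≠ k * Real.pi / 2) :
    0 < ∫ g, limitOverlap q γ β L g ^ 2 ∂(gaussianReal 0 1) := by
  have hcont : Continuous fun g => limitOverlap q γ β L g ^ 2 :=
    (continuous_limitOverlap q γ β L).pow 2
  have hint : Integrable (fun g => limitOverlap q γ β L g ^ 2) (gaussianReal 0 1) :=
    Integrable.of_bound (C := 1) hcont.aestronglyMeasurable (ae_of_all _ fun g => by
      rw [norm_pow]
      exact pow_le_one₀ (norm_nonneg _) (abs_limitOverlap_le q γ β L g))
  have hsin : Real.sin (2 * β) ≠ 0 := by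
    intro h
    obtain ⟨k, hk⟩ := Real.sin_eq_zero_iff.1 h
    exact hβ k (by linarith)
  rw [integral_pos_iff_support_of_nonneg (fun g => sq_nonneg _) hint]
  have hopen : IsOpen (Function.support fun g => limitOverlap q γ β L g ^ 2) :=
    hcont.isOpen_support
  have hq0 : (0 : ℝ) < q := by exact_mod_cast (by omega : 0 < q)
  have hne : (Function.support fun g => limitOverlap q γ β L g ^ 2).Nonempty := by
    set c := 2 * q * L * γ with hc
    have hc0 : 0 < c := by positivity
    -- The point where the argument of the outer sine equals `π/2`; the root exists because `q - 1 ≠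
    -- 0`, which uses `2 ≤ q`.
    refine ⟨(Real.pi / 2 / c) ^ ((q - 1 : ℕ) : ℝ)⁻¹, ?_⟩
    rw [Function.mem_support]
    refine pow_ne_zero 2 ?_
    rw [limitOverlap, ← hc, Real.rpow_inv_natCast_pow (by positivity) (by omega),
      mul_div_cancel₀ _ hc0.ne', Real.sin_pi_div_two, mul_one]
    exact mul_ne_zero (Real.exp_pos _).ne' hsin
  have hvol := hopen.measure_pos volume hne
  rw [pos_iff_ne_zero] at hvol ⊢
  exact fun h0 => hvol (gaussianReal_absolutelyContinuous' 0 one_ne_zero h0)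

end SpikedTensorQAOA

end

theorem mainTheorem1 (q : ℕ) (hq : 2 ≤ q) :
    -- (a) below the threshold the second moment of the overlap vanishes
    (∀ γs βs lam : ℕ → ℝ,
      (∀ n, βs n ∈ Set.Icc 0 (2 * Real.pi)) →
      (∀ n, 0 ≤ lam n) →
      Tendsto (fun n : ℕ => lam n / (n : ℝ) ^ (((q : ℝ) - 1) / 2)) atTop (𝓝 0) →
      Tendsto (fun n : ℕ => SpikedTensorQAOA.secondMoment q n (lam n) (γs n) (βs n))
        atTop (𝓝 0)) ∧
    (∀ (γs βs lam : ℕ → ℝ) (γ β Lam : ℝ),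
      Tendsto γs atTop (𝓝 γ) →
      Tendsto βs atTop (𝓝 β) →
      Tendsto (fun n : ℕ => lam n / (n : ℝ) ^ (((q : ℝ) - 1) / 2)) atTop (𝓝 Lam) →
      -- (b) the overlap converges in distribution to the sine-Gaussian law
      TendstoInDistribution
        (fun n : ℕ => SpikedTensorQAOA.overlapRV q n) atTop
        (fun G : ℝ => Real.exp (-2 * q * γ ^ 2) * Real.sin (2 * β) *
          Real.sin (2 * q * Lam * γ * G ^ (q - 1)))
        (fun n : ℕ => SpikedTensorQAOA.jointLaw q n (lam n) (γs n) (βs n))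
        (gaussianReal 0 1) ∧
      -- (c) the second moment has a positive limit
      (0 < Lam → 0 < γ → (∀ k : ℤ, β ≠ k * Real.pi / 2) →
        ∃ L : ℝ, 0 < L ∧
          Tendsto (fun n : ℕ => SpikedTensorQAOA.secondMoment q n (lam n) (γs n) (βs n))
            atTop (𝓝 L))) := by
  have hq1 : 1 ≤ q := by omega
  refine ⟨fun γs βs lam _ _ hL => SpikedTensorQAOA.tendsto_secondMoment_zero hq1 γs βs lam hL,
    fun γs βs lam γ β Lam hγ hβ hL => ⟨?_, fun hLam hγ0 hβ0 => ?_⟩⟩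
  · exact SpikedTensorQAOA.tendstoInDistribution_of_moments
      (SpikedTensorQAOA.measurable_overlapRV q)
      (SpikedTensorQAOA.continuous_limitOverlap q γ β Lam).measurable
      (fun n ω => SpikedTensorQAOA.abs_overlap_le _ _)
      (SpikedTensorQAOA.abs_limitOverlap_le q γ β Lam)
      fun k => SpikedTensorQAOA.tendsto_integral_overlap_pow hq1 k hγ hβ hL
  · refine ⟨_, SpikedTensorQAOA.integral_limitOverlap_sq_pos hq hLam hγ0 hβ0, ?_⟩
    simp only [SpikedTensorQAOA.secondMoment_eq]
    exact SpikedTensorQAOA.tendsto_integral_overlap_pow hq1 2 hγ hβ hL
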